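/- **Term graphs.** Let $B$ be a set of basic attack step labels. The signature $\mathsf{AT}(B)$ consists of function symbols $\mathrm{AND}_i,\mathrm{OR}_i$ of arity $i$ for each $i\ge 1$, and a symbol of arity $0$ for each $b\in B$. A *term graph* $T\colon i\to j$ over a signature $\Sigma$ consists of a finite set $N^T$ of nodes, a duplicate-free list of $i$ input nodes, a list of $j$ output nodes (repetitions allowed), and, for each non-input node $n$, a label $\mathrm{lab}^T(n)\in\Sigma$ and a list $\mathrm{ch}^T(n)$ of children in $N^T$, of length the arity of the label, such that the directed graph of parent-child edges is acyclic. Term graphs are taken up to isomorphism. Their sequential composition $T\circ S$ glues the $l$-th output of $S$ to the $l$-th input of $T$; their parallel composition $S\otimes T$ is the disjoint union, with the inputs and outputs of $S$ listed first. The graphs $\mathsf{id}_i$, $\mathsf{swap}_{i,j}$ (exchanging the first $i$ with the last $j$ wires), $\mathsf{copy}\colon 1\to 2$, $\mathsf{del}\colon 1\to 0$ have only input nodes, and $\langle f\rangle$ is the graph with one node labelled $f$, which is the output, whose children are the $\mathrm{arity}(f)$ input nodes in order. An *attack tree* over $B$ is an $\mathsf{AT}(B)$-term graph $T\colon 0\to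 1$. **Stochastic matrices.** Let $R$ be a semiring, meaning here a set with two associative commutative operations $+,\cdot$ with units $0,1$, where $\cdot$ distributes over $+$ (it is not required that $0\cdot r=0$). Let $\mathsf{BoolStoch}_R(i,j)$ be the set of matrices $A\in R^{2^j\times 2^i}$, with rows and columns indexed by Boolean vectors, such that $\sum_{y}A_{yx}=1$ for all $x\in 2^i$. Here $\circ$ is matrix multiplication, $\otimes$ is the Kronecker product, $\mathsf{id}_i$ is the identity matrix, $\mathsf{swap}_{i,j}$ is the permutation matrix exchanging the first $i$ with the last $j$ coordinates, $\mathsf{copy}$ is the $0$-$1$-matrix of $x\mapsto(x,x)$ and $\mathsf{del}=(1\ 1)$. **Semantics.** Let $\alpha_0,\alpha_1\colon B\to R$ satisfy $\alpha_0(b)+\alpha_1(b)=1$ for all $b\in B$. The stochastic matrix interpretation $\mathcal I=\mathcal I^{\alpha}_{\mathsf{stoch}}$ sends $\mathrm{AND}_i$ and $\mathrm{OR}_i$ to the $0$-$1$-matrices in $R^{2\times 2^i}$ of $i$-fold conjunction and disjunction, and $b$ to the column $(\alpha_0(b),\alpha_1(b))^\top$. A functor of channel categories from term graphs to $\mathsf{BoolStoch}_R$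 is a family of maps on the sets of channels $i\to j$ ($i,j\ge 0$) preserving $\circ,\otimes,\mathsf{id}_i,\mathsf{swap}_{i,j},\mathsf{copy},\mathsf{del}$. The semantics $[\![\,\cdot\,]\!]_{\mathcal I}$ is the unique functor of channel categories from $\mathsf{AT}(B)$-term graphs to $\mathsf{BoolStoch}_R$ with $[\![\langle f\rangle]\!]_{\mathcal I}=\mathcal I(f)$ for all $f\in\mathsf{AT}(B)$. **Attacks.** For an attack tree $T$, let $\mathsf{BAS}(T)$ be the set of nodes labelled by elements of $B$. An attack is a function $a\colon\mathsf{BAS}(T)\to\{0,1\}$. Its value at a node is defined recursively: $a(n)$ at $n\in\mathsf{BAS}(T)$, the conjunction of the values of the children at an AND node, and their disjunction at an OR node. Let $\mathsf{Suc}_T$ be the set of attacks whose value at the output node is $1$. For $v\in\mathsf{BAS}(T)$ write $\overline\alpha_i(v)=\alpha_i(\mathrm{lab}^T(v))$. **Corollary.** There is exactly one functor $[\![\,\cdot\,]\!]_{\mathcal I}$ as above, and for every attack tree $T$ over $B$ the second component (index $1$) of the vector $[\![T]\!]_{\mathcal I}\in R^2$ is $$\big([\![T]\!]_{\mathcal I}\big)_1=\sum_{a\in\mathsf{Suc}_T}\Big(\prod_{v\in\mathsf{BAS}(T),\,a(v)=1}\overline\alpha_1(v)\Big)\cdot\Big(\prod_{v\in\mathsf{BAS}(T),\,a(v)=0}\overline\alpha_0(v)\Big).$$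 -/

import Mathlib

namespace ChannelSemantics

universe u v w

/-! ## Signatures and term graphs -/

/-- A single-sorted algebraic signature: function symbols with arities. -/
structure Signature where
  Symbol : Type u
  arity : Symbol → ℕ

/-- A term graph `i → j` over `S`, with its chosen finite set of nodes. The list of `i` input nodes
(without duplicates) and the list of `j` output nodes are given as families indexed by `Fin i` and
`Fin j`. Labels and children are defined exactly on the non-input nodes. -/
structure TermGraph (S : Signature.{u}) (i j : ℕ) where
  Node : Type
  finite_node : Finite Node
  inputs : Fin i → Node
  outputs : Fin j → Node
  label : {n : Node // n ∉ Set.range inputs} → S.Symbol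
  children : {n : Node // n ∉ Set.range inputs} → List Node
  arity_label : ∀ n, S.arity (label n) = (children n).length
  acyclic : ∀ n : Node, ¬ Relation.TransGen
    (fun p c : Node => ∃ h : p ∉ Set.range inputs, c ∈ children ⟨p, h⟩) n n
  inputs_injective : Function.Injective inputs

namespace TermGraph

variable {S : Signature.{u}} {i j k l : ℕ}

/-- The type of non-input nodes. -/
abbrev NonInput (T : TermGraph S i j) : Type := {n : T.Node // n ∉ Set.range T.inputs}

/-- The edge relation: `T.Edge p c` means that `c` is a child of the non-input node `p`. -/
def Edge (T : TermGraph S i j) (p c : T.Node) : Prop :=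
  ∃ h : p ∉ Set.range T.inputs, c ∈ T.children ⟨p, h⟩

instance (T : TermGraph S i j) : Finite T.Node := T.finite_node

theorem edge_acyclic (T : TermGraph S i j) (n : T.Node) : ¬ Relation.TransGen T.Edge n n :=
  T.acyclic n

theorem wellFounded_child (T : TermGraph S i j) :
    WellFounded (fun c p : T.Node => T.Edge p c) := by
  have h1 : WellFounded (fun c p : T.Node => Relation.TransGen T.Edge p c) :=
    @Finite.wellFounded_of_trans_of_irrefl T.Node _
      (fun c p : T.Node => Relation.TransGen T.Edge p c)
      ⟨fun _ _ _ hab hbc => hbc.trans hab⟩ ⟨fun a => T.edge_acyclic a⟩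
  exact Subrelation.wf (fun {_ _} h => Relation.TransGen.single h) h1

/-- An isomorphism of term graphs: a bijection of the nodes that preserves the input and output
nodes with their order, the labels and the lists of children. -/
structure Iso (T T' : TermGraph S i j) where
  toEquiv : T.Node ≃ T'.Node
  map_inputs : ∀ a, toEquiv (T.inputs a) = T'.inputs a
  map_outputs : ∀ a, toEquiv (T.outputs a) = T'.outputs a
  map_label : ∀ n (h : n ∉ Set.range T.inputs) (h' : toEquiv n ∉ Set.range T'.inputs),
    T'.label ⟨toEquiv n, h'⟩ = T.label ⟨n, h⟩
  map_children : ∀ n (h : n ∉ Set.range T.inputs) (h' : toEquiv n ∉ Set.range T'.inputs),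
    T'.children ⟨toEquiv n, h'⟩ = (T.children ⟨n, h⟩).map toEquiv

theorem Iso.mem_range_iff {T T' : TermGraph S i j} (e : Iso T T') (n : T.Node) :
    e.toEquiv n ∈ Set.range T'.inputs ↔ n ∈ Set.range T.inputs := by
  constructor
  · rintro ⟨a, ha⟩
    exact ⟨a, e.toEquiv.injective (by rw [e.map_inputs, ha])⟩
  · rintro ⟨a, rfl⟩
    exact ⟨a, (e.map_inputs a).symm⟩

/-- The identity isomorphism. -/
def Iso.refl (T : TermGraph S i j) : Iso T T where
  toEquiv := Equiv.refl _
  map_inputs _ := rfl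
  map_outputs _ := rfl
  map_label _ _ _ := rfl
  map_children _ _ _ := by simp

/-- The composite of two isomorphisms. -/
def Iso.trans {T T' T'' : TermGraph S i j} (e : Iso T T') (f : Iso T' T'') : Iso T T'' where
  toEquiv := e.toEquiv.trans f.toEquiv
  map_inputs a := by simp [e.map_inputs, f.map_inputs]
  map_outputs a := by simp [e.map_outputs, f.map_outputs]
  map_label n h h' := by
    have h1 : e.toEquiv n ∉ Set.range T'.inputs := fun hh => h ((e.mem_range_iff n).1 hh)
    exact (f.map_label _ h1 h').trans (e.map_label n h h1)
  map_children n h h' := by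
    have h1 : e.toEquiv n ∉ Set.range T'.inputs := fun hh => h ((e.mem_range_iff n).1 hh)
    refine (f.map_children _ h1 h').trans ?_
    rw [e.map_children n h h1, List.map_map]
    rfl

/-- The inverse isomorphism. -/
def Iso.symm {T T' : TermGraph S i j} (e : Iso T T') : Iso T' T where
  toEquiv := e.toEquiv.symm
  map_inputs a := by rw [← e.map_inputs, Equiv.symm_apply_apply]
  map_outputs a := by rw [← e.map_outputs, Equiv.symm_apply_apply]
  map_label n h h' := by
    obtain ⟨m, rfl⟩ := e.toEquiv.surjective n
    have hm : m ∉ Set.range T.inputs := fun hh => h ((e.mem_range_iff m).2 hh)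
    have h2 := e.map_label m hm h
    rw [h2]
    congr 2
    exact e.toEquiv.symm_apply_apply m
  map_children n h h' := by
    obtain ⟨m, rfl⟩ := e.toEquiv.surjective n
    have hm : m ∉ Set.range T.inputs := fun hh => h ((e.mem_range_iff m).2 hh)
    have h2 := e.map_children m hm h
    rw [h2, List.map_map]
    simp

/-- Being isomorphic is an equivalence relation. -/
instance isoSetoid (S : Signature.{u}) (i j : ℕ) : Setoid (TermGraph S i j) where
  r T T' := Nonempty (Iso T T')
  iseqv := ⟨fun T => ⟨Iso.refl T⟩, fun ⟨e⟩ => ⟨e.symm⟩, fun ⟨e⟩ ⟨f⟩ => ⟨e.trans f⟩⟩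

/-! ### Sequential composition -/

/-- The nodes of the composite `T ∘ G`: the nodes of `G` together with the non-input nodes of `T`.
See `glueEquiv`: this is the quotient of the disjoint union of the two sets of nodes by the gluing
of the outputs of `G` to the inputs of `T`. -/
abbrev CompNode (T : TermGraph S j k) (G : TermGraph S i j) : Type := G.Node ⊕ T.NonInput

open Classical in
/-- The canonical map from the nodes of `T` to the nodes of the composite `T ∘ G`. The `a`-th input
node of `T` is identified with the `a`-th output node of `G`. -/
noncomputable def glue (T : TermGraph S j k) (G : TermGraph S i j) (n : T.Node) : CompNode T G :=
  if h : n ∈ Set.range T.inputs then Sum.inl (G.outputs h.choose) else Sum.inr ⟨n, h⟩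

theorem glue_inputs (T : TermGraph S j k) (G : TermGraph S i j) (a : Fin j) :
    glue T G (T.inputs a) = Sum.inl (G.outputs a) := by
  have h : T.inputs a ∈ Set.range T.inputs := ⟨a, rfl⟩
  unfold glue
  rw [dif_pos h, T.inputs_injective h.choose_spec]

theorem glue_nonInput (T : TermGraph S j k) (G : TermGraph S i j) (n : T.NonInput) :
    glue T G n.1 = Sum.inr n := by
  unfold glue
  rw [dif_neg n.2]

/-- The relation on the disjoint union of the sets of nodes that identifies the `a`-th output node
of `G` with the `a`-th input node of `T`. -/
inductive GlueRel (T : TermGraph S j k) (G : TermGraph S i j) :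
    G.Node ⊕ T.Node → G.Node ⊕ T.Node → Prop
  | glue (a : Fin j) : GlueRel T G (Sum.inl (G.outputs a)) (Sum.inr (T.inputs a))

/-- `CompNode T G` is the quotient of the disjoint union of the nodes of `G` and of `T` by the
equivalence relation generated by `GlueRel T G`. -/
noncomputable def glueEquiv (T : TermGraph S j k) (G : TermGraph S i j) :
    Quot (GlueRel T G) ≃ CompNode T G where
  toFun := Quot.lift (Sum.elim Sum.inl (glue T G)) (by
    rintro _ _ ⟨a⟩
    exact (glue_inputs T G a).symm)
  invFun := Sum.elim (fun n => Quot.mk _ (Sum.inl n)) (fun n => Quot.mk _ (Sum.inr n.1))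
  left_inv := by
    rintro ⟨n | n⟩
    · rfl
    · by_cases h : n ∈ Set.range T.inputs
      · obtain ⟨a, rfl⟩ := h
        change Sum.elim _ _ (glue T G (T.inputs a)) = _
        rw [glue_inputs]
        exact Quot.sound (GlueRel.glue a)
      · change Sum.elim _ _ (glue T G n) = _
        rw [glue_nonInput T G ⟨n, h⟩]
        rfl
  right_inv := by
    rintro (n | n)
    · rfl
    · exact glue_nonInput T G n

/-- The input nodes of the composite are those of `G`. -/
def compInputs (T : TermGraph S j k) (G : TermGraph S i j) (a : Fin i) : CompNode T G :=
  Sum.inl (G.inputs a)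

/-- The label of a non-input node of the composite. -/
def compLabel (T : TermGraph S j k) (G : TermGraph S i j) :
    {n : CompNode T G // n ∉ Set.range (compInputs T G)} → S.Symbol
  | ⟨Sum.inl n, h⟩ => G.label ⟨n, fun ⟨a, ha⟩ => h ⟨a, congrArg Sum.inl ha⟩⟩
  | ⟨Sum.inr n, _⟩ => T.label n

/-- The children of a non-input node of the composite. -/
noncomputable def compChildren (T : TermGraph S j k) (G : TermGraph S i j) :
    {n : CompNode T G // n ∉ Set.range (compInputs T G)} → List (CompNode T G)
  | ⟨Sum.inl n, h⟩ =>
      (G.children ⟨n, fun ⟨a, ha⟩ => h ⟨a, congrArg Sum.inl ha⟩⟩).map Sum.inl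
  | ⟨Sum.inr n, _⟩ => (T.children n).map (glue T G)

theorem comp_acyclic (T : TermGraph S j k) (G : TermGraph S i j) (n : CompNode T G) :
    ¬ Relation.TransGen (fun p c : CompNode T G =>
      ∃ h : p ∉ Set.range (compInputs T G), c ∈ compChildren T G ⟨p, h⟩) n n := by
  have key : ∀ p c : CompNode T G, Relation.TransGen (fun p c : CompNode T G =>
      ∃ h : p ∉ Set.range (compInputs T G), c ∈ compChildren T G ⟨p, h⟩) p c →
      (∀ p', p = Sum.inl p' → ∃ c', c = Sum.inl c' ∧ Relation.TransGen G.Edge p' c') ∧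
      (∀ p' c', p = Sum.inr p' → c = Sum.inr c' → Relation.TransGen T.Edge p'.1 c'.1) := by
    have hl : ∀ (p : G.Node) (c : CompNode T G),
        (∃ h : (Sum.inl p : CompNode T G) ∉ Set.range (compInputs T G),
          c ∈ compChildren T G ⟨Sum.inl p, h⟩) → ∃ c', c = Sum.inl c' ∧ G.Edge p c' := by
      rintro p c ⟨h, hc⟩
      obtain ⟨c', hc', rfl⟩ := List.mem_map.1 hc
      exact ⟨c', rfl, _, hc'⟩
    have hr : ∀ (p c : T.NonInput),
        (∃ h : (Sum.inr p : CompNode T G) ∉ Set.range (compInputs T G),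
          (Sum.inr c : CompNode T G) ∈ compChildren T G ⟨Sum.inr p, h⟩) → T.Edge p.1 c.1 := by
      rintro p c ⟨h, hc⟩
      obtain ⟨c', hc', he⟩ := List.mem_map.1 hc
      refine ⟨p.2, ?_⟩
      by_cases h' : c' ∈ Set.range T.inputs
      · obtain ⟨a, rfl⟩ := h'
        rw [glue_inputs] at he
        cases he
      · rw [glue_nonInput T G ⟨c', h'⟩] at he
        cases he
        exact hc'
    intro p c hpc
    induction hpc with
    | single h =>
      refine ⟨?_, ?_⟩
      · rintro p' rfl
        obtain ⟨c', rfl, he⟩ := hl _ _ h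
        exact ⟨c', rfl, .single he⟩
      · rintro p' c' rfl rfl
        exact .single (hr _ _ h)
    | @tail b c _ h ih =>
      refine ⟨?_, ?_⟩
      · rintro p' rfl
        obtain ⟨b', rfl, hb⟩ := ih.1 _ rfl
        obtain ⟨c', rfl, he⟩ := hl _ _ h
        exact ⟨c', rfl, hb.tail he⟩
      · rintro p' c' rfl rfl
        rcases b with b | b
        · obtain ⟨c'', hc'', -⟩ := hl _ _ h
          cases hc''
        · exact (ih.2 _ _ rfl rfl).tail (hr _ _ h)
  intro h
  rcases n with n | n
  · obtain ⟨c', hc', ht⟩ := (key _ _ h).1 n rfl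
    cases hc'
    exact G.edge_acyclic n ht
  · exact T.edge_acyclic n.1 ((key _ _ h).2 n n rfl rfl)

/-- The sequential composition `T ∘ G` of term graphs: the outputs of `G` are glued to the inputs
of `T`. -/
noncomputable def comp (T : TermGraph S j k) (G : TermGraph S i j) : TermGraph S i k where
  Node := CompNode T G
  finite_node := inferInstance
  inputs := compInputs T G
  outputs := fun a => glue T G (T.outputs a)
  label := compLabel T G
  children := compChildren T G
  arity_label := by
    rintro ⟨n | n, h⟩
    · simp [compLabel, compChildren, G.arity_label]
    · simp [compLabel, compChildren, T.arity_label]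
  acyclic := comp_acyclic T G
  inputs_injective := fun _ _ h => G.inputs_injective (Sum.inl_injective h)

theorem map_map_congr {α β γ δ : Type*} {f : α → β} {g : β → δ} {f' : α → γ} {g' : γ → δ}
    (h : ∀ m, g (f m) = g' (f' m)) (t : List α) : (t.map f).map g = (t.map f').map g' := by
  rw [List.map_map, List.map_map]
  exact List.map_congr_left fun m _ => h m

theorem glue_congr {T T' : TermGraph S j k} {G G' : TermGraph S i j}
    (e : Iso T T') (f : Iso G G') (n : T.Node) :
    (Equiv.sumCongr f.toEquiv
      (e.toEquiv.subtypeEquiv fun n => not_congr (e.mem_range_iff n).symm)) (glue T G n) =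
      glue T' G' (e.toEquiv n) := by
  by_cases h : n ∈ Set.range T.inputs
  · obtain ⟨a, rfl⟩ := h
    rw [glue_inputs, e.map_inputs, glue_inputs]
    exact congrArg Sum.inl (f.map_outputs a)
  · rw [glue_nonInput T G ⟨n, h⟩,
      glue_nonInput T' G' ⟨e.toEquiv n, fun hh => h ((e.mem_range_iff n).1 hh)⟩]
    rfl

/-- Sequential composition respects isomorphism. -/
noncomputable def compCongr {T T' : TermGraph S j k} {G G' : TermGraph S i j}
    (e : Iso T T') (f : Iso G G') : Iso (comp T G) (comp T' G') where
  toEquiv := Equiv.sumCongr f.toEquiv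
    (e.toEquiv.subtypeEquiv fun n => not_congr (e.mem_range_iff n).symm)
  map_inputs a := congrArg Sum.inl (f.map_inputs a)
  map_outputs a := by
    change (Equiv.sumCongr _ _) (glue T G (T.outputs a)) = glue T' G' (T'.outputs a)
    rw [← e.map_outputs]
    exact glue_congr e f _
  map_label := by
    rintro (n | n) h h'
    · exact f.map_label _ _ _
    · exact e.map_label n.1 n.2 _
  map_children := by
    rintro (n | n) h h'
    · refine (congrArg (List.map Sum.inl) (f.map_children n
        (fun ⟨a, ha⟩ => h ⟨a, congrArg Sum.inl ha⟩)
        (fun ⟨a, ha⟩ => h' ⟨a, congrArg Sum.inl ha⟩))).trans ?_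
      change _ = List.map _ (List.map Sum.inl _)
      refine map_map_congr (fun m => ?_) _
      rfl
    · refine (congrArg (List.map (glue T' G')) (e.map_children n.1 n.2
        (fun hh => n.2 ((e.mem_range_iff _).1 hh)))).trans ?_
      exact map_map_congr (fun m => (glue_congr e f m).symm) _

/-! ### Parallel composition -/

/-- The input nodes of the parallel composition: first those of `G`, then those of `T`. -/
def tensorInputs (G : TermGraph S i j) (T : TermGraph S k l) : Fin (i + k) → G.Node ⊕ T.Node :=
  Fin.append (fun a => Sum.inl (G.inputs a)) (fun a => Sum.inr (T.inputs a))

/-- The output nodes of the parallel composition: first those of `G`, then those of `T`. -/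
def tensorOutputs (G : TermGraph S i j) (T : TermGraph S k l) : Fin (j + l) → G.Node ⊕ T.Node :=
  Fin.append (fun a => Sum.inl (G.outputs a)) (fun a => Sum.inr (T.outputs a))

theorem inl_mem_tensorInputs (G : TermGraph S i j) (T : TermGraph S k l) (n : G.Node) :
    (Sum.inl n : G.Node ⊕ T.Node) ∈ Set.range (tensorInputs G T) ↔ n ∈ Set.range G.inputs := by
  constructor
  · rintro ⟨a, ha⟩
    refine Fin.addCases (fun b hb => ?_) (fun b hb => ?_) a ha
    · rw [tensorInputs, Fin.append_left] at hb
      exact ⟨b, Sum.inl_injective hb⟩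
    · rw [tensorInputs, Fin.append_right] at hb
      cases hb
  · rintro ⟨b, rfl⟩
    exact ⟨Fin.castAdd k b, by rw [tensorInputs, Fin.append_left]⟩

theorem inr_mem_tensorInputs (G : TermGraph S i j) (T : TermGraph S k l) (n : T.Node) :
    (Sum.inr n : G.Node ⊕ T.Node) ∈ Set.range (tensorInputs G T) ↔ n ∈ Set.range T.inputs := by
  constructor
  · rintro ⟨a, ha⟩
    refine Fin.addCases (fun b hb => ?_) (fun b hb => ?_) a ha
    · rw [tensorInputs, Fin.append_left] at hb
      cases hb
    · rw [tensorInputs, Fin.append_right] at hb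
      exact ⟨b, Sum.inr_injective hb⟩
  · rintro ⟨b, rfl⟩
    exact ⟨Fin.natAdd i b, by rw [tensorInputs, Fin.append_right]⟩

/-- The label of a non-input node of the parallel composition. -/
def tensorLabel (G : TermGraph S i j) (T : TermGraph S k l) :
    {n : G.Node ⊕ T.Node // n ∉ Set.range (tensorInputs G T)} → S.Symbol
  | ⟨Sum.inl n, h⟩ => G.label ⟨n, fun hn => h ((inl_mem_tensorInputs G T n).2 hn)⟩
  | ⟨Sum.inr n, h⟩ => T.label ⟨n, fun hn => h ((inr_mem_tensorInputs G T n).2 hn)⟩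

/-- The children of a non-input node of the parallel composition. -/
def tensorChildren (G : TermGraph S i j) (T : TermGraph S k l) :
    {n : G.Node ⊕ T.Node // n ∉ Set.range (tensorInputs G T)} → List (G.Node ⊕ T.Node)
  | ⟨Sum.inl n, h⟩ =>
      (G.children ⟨n, fun hn => h ((inl_mem_tensorInputs G T n).2 hn)⟩).map Sum.inl
  | ⟨Sum.inr n, h⟩ =>
      (T.children ⟨n, fun hn => h ((inr_mem_tensorInputs G T n).2 hn)⟩).map Sum.inr

theorem tensor_acyclic (G : TermGraph S i j) (T : TermGraph S k l) (n : G.Node ⊕ T.Node) :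
    ¬ Relation.TransGen (fun p c : G.Node ⊕ T.Node =>
      ∃ h : p ∉ Set.range (tensorInputs G T), c ∈ tensorChildren G T ⟨p, h⟩) n n := by
  have key : ∀ p c : G.Node ⊕ T.Node, Relation.TransGen (fun p c : G.Node ⊕ T.Node =>
      ∃ h : p ∉ Set.range (tensorInputs G T), c ∈ tensorChildren G T ⟨p, h⟩) p c →
      (∀ p', p = Sum.inl p' → ∃ c', c = Sum.inl c' ∧ Relation.TransGen G.Edge p' c') ∧
      (∀ p', p = Sum.inr p' → ∃ c', c = Sum.inr c' ∧ Relation.TransGen T.Edge p' c') := by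
    have hl : ∀ (p : G.Node) (c : G.Node ⊕ T.Node),
        (∃ h : (Sum.inl p : G.Node ⊕ T.Node) ∉ Set.range (tensorInputs G T),
          c ∈ tensorChildren G T ⟨Sum.inl p, h⟩) → ∃ c', c = Sum.inl c' ∧ G.Edge p c' := by
      rintro p c ⟨h, hc⟩
      obtain ⟨c', hc', rfl⟩ := List.mem_map.1 hc
      exact ⟨c', rfl, _, hc'⟩
    have hr : ∀ (p : T.Node) (c : G.Node ⊕ T.Node),
        (∃ h : (Sum.inr p : G.Node ⊕ T.Node) ∉ Set.range (tensorInputs G T),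
          c ∈ tensorChildren G T ⟨Sum.inr p, h⟩) → ∃ c', c = Sum.inr c' ∧ T.Edge p c' := by
      rintro p c ⟨h, hc⟩
      obtain ⟨c', hc', rfl⟩ := List.mem_map.1 hc
      exact ⟨c', rfl, _, hc'⟩
    intro p c hpc
    induction hpc with
    | single h =>
      refine ⟨?_, ?_⟩
      · rintro p' rfl
        obtain ⟨c', rfl, he⟩ := hl _ _ h
        exact ⟨c', rfl, .single he⟩
      · rintro p' rfl
        obtain ⟨c', rfl, he⟩ := hr _ _ h
        exact ⟨c', rfl, .single he⟩
    | tail _ h ih =>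
      refine ⟨?_, ?_⟩
      · rintro p' rfl
        obtain ⟨b', rfl, hb⟩ := ih.1 _ rfl
        obtain ⟨c', rfl, he⟩ := hl _ _ h
        exact ⟨c', rfl, hb.tail he⟩
      · rintro p' rfl
        obtain ⟨b', rfl, hb⟩ := ih.2 _ rfl
        obtain ⟨c', rfl, he⟩ := hr _ _ h
        exact ⟨c', rfl, hb.tail he⟩
  intro h
  rcases n with n | n
  · obtain ⟨c', hc', ht⟩ := (key _ _ h).1 n rfl
    cases hc'
    exact G.edge_acyclic n ht
  · obtain ⟨c', hc', ht⟩ := (key _ _ h).2 n rfl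
    cases hc'
    exact T.edge_acyclic n ht

/-- The parallel composition `G ⊗ T` of term graphs: the disjoint union, with the inputs and
outputs of `G` listed before those of `T`. -/
def tensor (G : TermGraph S i j) (T : TermGraph S k l) : TermGraph S (i + k) (j + l) where
  Node := G.Node ⊕ T.Node
  finite_node := inferInstance
  inputs := tensorInputs G T
  outputs := tensorOutputs G T
  label := tensorLabel G T
  children := tensorChildren G T
  arity_label := by
    rintro ⟨n | n, h⟩
    · simp [tensorLabel, tensorChildren, G.arity_label]
    · simp [tensorLabel, tensorChildren, T.arity_label]
  acyclic := tensor_acyclic G T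
  inputs_injective := by
    intro a b
    refine Fin.addCases (fun a' => ?_) (fun a' => ?_) a <;>
      refine Fin.addCases (fun b' => ?_) (fun b' => ?_) b <;>
      simp only [tensorInputs, Fin.append_left, Fin.append_right] <;> intro h
    · rw [G.inputs_injective (Sum.inl_injective h)]
    · cases h
    · cases h
    · rw [T.inputs_injective (Sum.inr_injective h)]

/-- Parallel composition respects isomorphism. -/
def tensorCongr {G G' : TermGraph S i j} {T T' : TermGraph S k l}
    (f : Iso G G') (e : Iso T T') : Iso (tensor G T) (tensor G' T') where
  toEquiv := Equiv.sumCongr f.toEquiv e.toEquiv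
  map_inputs a := by
    change (Equiv.sumCongr _ _) (tensorInputs G T a) = tensorInputs G' T' a
    refine Fin.addCases (fun b => ?_) (fun b => ?_) a
    · simp [tensorInputs, f.map_inputs]
    · simp [tensorInputs, e.map_inputs]
  map_outputs a := by
    change (Equiv.sumCongr _ _) (tensorOutputs G T a) = tensorOutputs G' T' a
    refine Fin.addCases (fun b => ?_) (fun b => ?_) a
    · simp [tensorOutputs, f.map_outputs]
    · simp [tensorOutputs, e.map_outputs]
  map_label := by
    rintro (n | n) h h'
    · exact f.map_label _ _ _
    · exact e.map_label _ _ _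
  map_children := by
    rintro (n | n) h h'
    · refine (congrArg (List.map Sum.inl) (f.map_children n
        (fun hn => h ((inl_mem_tensorInputs G T n).2 hn))
        (fun hn => h' ((inl_mem_tensorInputs G' T' _).2 hn)))).trans ?_
      change _ = List.map _ (List.map Sum.inl _)
      refine map_map_congr (fun m => ?_) _
      rfl
    · refine (congrArg (List.map Sum.inr) (e.map_children n
        (fun hn => h ((inr_mem_tensorInputs G T n).2 hn))
        (fun hn => h' ((inr_mem_tensorInputs G' T' _).2 hn)))).trans ?_
      change _ = List.map _ (List.map Sum.inr _)
      refine map_map_congr (fun m => ?_) _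
      rfl

/-! ### Atomic term graphs -/

/-- The term graph `i → j` whose only nodes are its `i` input nodes and whose `a`-th output is the
`w a`-th input. -/
def wiring (S : Signature.{u}) (w : Fin j → Fin i) : TermGraph S i j where
  Node := Fin i
  finite_node := inferInstance
  inputs := id
  outputs := w
  label n := (n.2 ⟨n.1, rfl⟩).elim
  children _ := []
  arity_label n := (n.2 ⟨n.1, rfl⟩).elim
  acyclic n h := by
    obtain ⟨c, ⟨h', -⟩, -⟩ := Relation.TransGen.head'_iff.1 h
    exact h' ⟨n, rfl⟩
  inputs_injective := Function.injective_id

/-- The term graph `⟨f⟩` of a function symbol `f`: one input node `some a` for each argument, and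
one further node `none`, which is labelled by `f`, has all the inputs as children, in order, and is
the output. -/
def ofSymbol (S : Signature.{u}) (f : S.Symbol) : TermGraph S (S.arity f) 1 where
  Node := Option (Fin (S.arity f))
  finite_node := inferInstance
  inputs := some
  outputs _ := none
  label _ := f
  children _ := (List.finRange (S.arity f)).map some
  arity_label n := by simp
  acyclic n h := by
    have h1 : ∀ p c : Option (Fin (S.arity f)), Relation.TransGen
        (fun p c : Option (Fin (S.arity f)) => ∃ _ : p ∉ Set.range some,
          c ∈ (List.finRange (S.arity f)).map some) p c →
        p ∉ Set.range (some : Fin (S.arity f) → _) ∧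
          c ∈ Set.range (some : Fin (S.arity f) → _) := by
      intro p c hpc
      induction hpc with
      | single h =>
        obtain ⟨h, hc⟩ := h
        obtain ⟨a, -, rfl⟩ := List.mem_map.1 hc
        exact ⟨h, a, rfl⟩
      | tail _ h ih =>
        exact (h.1 ih.2).elim
    exact (h1 n n h).1 (h1 n n h).2
  inputs_injective := Option.some_injective _

end TermGraph

/-! ## Channel categories and their functors -/

/-- The data of a channel category: channels with `i` inputs and `j` outputs, sequential and
parallel composition, identity, swap, copy and delete channels. The notion of a functor refers to
these data only; the two instances used are the explicitly constructed `termGraphs S` and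
`boolStoch R`. -/
structure ChannelStructure where
  Channel : ℕ → ℕ → Type w
  comp : ∀ {i j k : ℕ}, Channel j k → Channel i j → Channel i k
  tensor : ∀ {i j k l : ℕ}, Channel i j → Channel k l → Channel (i + k) (j + l)
  id : ∀ i : ℕ, Channel i i
  swap : ∀ i j : ℕ, Channel (i + j) (j + i)
  copy : Channel 1 2
  del : Channel 1 0

/-- A functor of channel categories. -/
structure ChannelFunctor (C : ChannelStructure.{v}) (D : ChannelStructure.{w}) where
  map : ∀ {i j : ℕ}, C.Channel i j → D.Channel i j
  map_comp : ∀ {i j k : ℕ} (g : C.Channel j k) (f : C.Channel i j),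
    map (C.comp g f) = D.comp (map g) (map f)
  map_tensor : ∀ {i j k l : ℕ} (g : C.Channel i j) (f : C.Channel k l),
    map (C.tensor g f) = D.tensor (map g) (map f)
  map_id : ∀ i : ℕ, map (C.id i) = D.id i
  map_swap : ∀ i j : ℕ, map (C.swap i j) = D.swap i j
  map_copy : map C.copy = D.copy
  map_del : map C.del = D.del

/-- The channel category of term graphs over `S`, up to isomorphism. -/
noncomputable def termGraphs (S : Signature.{u}) : ChannelStructure.{max 1 u} where
  Channel i j := Quotient (TermGraph.isoSetoid S i j)
  comp := Quotient.map₂ TermGraph.comp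
    (fun _ _ ⟨e⟩ _ _ ⟨f⟩ => ⟨TermGraph.compCongr e f⟩)
  tensor := Quotient.map₂ TermGraph.tensor
    (fun _ _ ⟨e⟩ _ _ ⟨f⟩ => ⟨TermGraph.tensorCongr e f⟩)
  id i := ⟦TermGraph.wiring S (fun a : Fin i => a)⟧
  swap i j := ⟦TermGraph.wiring S (fun a : Fin (j + i) => (finAddFlip a : Fin (i + j)))⟧
  copy := ⟦TermGraph.wiring S (fun _ : Fin 2 => (0 : Fin 1))⟧
  del := ⟦TermGraph.wiring S (fun a : Fin 0 => (a.elim0 : Fin 1))⟧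

/-- An interpretation of a signature in a channel category. -/
def Interpretation (S : Signature.{u}) (C : ChannelStructure.{w}) :=
  ∀ f : S.Symbol, C.Channel (S.arity f) 1

/-- The functor `F` extends the interpretation `I`, i.e. `F ⟨f⟩ = I f` for all symbols `f`. -/
def ChannelFunctor.Extends {S : Signature.{u}} {C : ChannelStructure.{w}}
    (F : ChannelFunctor (termGraphs S) C) (I : Interpretation S C) : Prop :=
  ∀ f : S.Symbol, F.map (⟦TermGraph.ofSymbol S f⟧ : (termGraphs S).Channel (S.arity f) 1) = I f

/-! ## Stochastic Boolean-indexed matrices -/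

/-- Semirings in the sense used for attack tree metrics: addition and multiplication are
associative and commutative with units `0` and `1`, and multiplication distributes over addition.
It is not required that `0 * r = 0`. -/
class MetricSemiring (R : Type v) extends AddCommMonoid R, CommMonoid R where
  mul_add : ∀ r s t : R, r * (s + t) = r * s + r * t

/-- Every commutative semiring is a `MetricSemiring`. -/
abbrev MetricSemiring.ofCommSemiring (R : Type v) [CommSemiring R] : MetricSemiring R where
  mul_add := _root_.mul_add

section BoolStoch

variable {R : Type v} [MetricSemiring R]

theorem MetricSemiring.mul_sum_of_nonempty {ι : Type*} (s : Finset ι) (hs : s.Nonempty)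
    (r : R) (f : ι → R) : r * ∑ a ∈ s, f a = ∑ a ∈ s, r * f a := by
  induction hs using Finset.Nonempty.cons_induction with
  | singleton a => simp
  | cons a s h hs ih => rw [Finset.sum_cons, Finset.sum_cons, MetricSemiring.mul_add, ih]

/-- The condition that every column of a Boolean-indexed matrix sums to `1`. -/
def IsStochastic {i j : ℕ} (A : Matrix (Fin j → Bool) (Fin i → Bool) R) : Prop :=
  ∀ x, ∑ y, A y x = 1

/-- Stochastic `2^j × 2^i`-matrices over `R`. -/
abbrev StochMatrix (R : Type v) [MetricSemiring R] (i j : ℕ) : Type v :=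
  {A : Matrix (Fin j → Bool) (Fin i → Bool) R // IsStochastic A}

namespace StochMatrix

variable {i j k l : ℕ}

/-- Matrix multiplication. -/
def comp (A : StochMatrix R j k) (A' : StochMatrix R i j) : StochMatrix R i k :=
  ⟨A.1 * A'.1, by
    intro x
    simp only [Matrix.mul_apply]
    rw [Finset.sum_comm]
    have h : ∀ z, ∑ y, A.1 y z * A'.1 z x = A'.1 z x := by
      intro z
      simp only [mul_comm _ (A'.1 z x)]
      rw [← MetricSemiring.mul_sum_of_nonempty _ Finset.univ_nonempty, A.2 z, mul_one]
    simp only [h]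
    exact A'.2 x⟩

/-- A Boolean vector of length `i + k`, as a pair of Boolean vectors of lengths `i` and `k`. -/
def split (i k : ℕ) (x : Fin (i + k) → Bool) : (Fin i → Bool) × (Fin k → Bool) :=
  (fun a => x (Fin.castAdd k a), fun a => x (Fin.natAdd i a))

/-- The Kronecker product. -/
def tensor (A : StochMatrix R i j) (A' : StochMatrix R k l) :
    StochMatrix R (i + k) (j + l) :=
  ⟨(Matrix.kroneckerMap (· * ·) A.1 A'.1).submatrix (split j l) (split i k), by
    intro x
    simp only [Matrix.submatrix_apply, Matrix.kroneckerMap_apply]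
    rw [← (Fin.appendEquiv j l).sum_comp
      (fun y => A.1 (split j l y).1 (split i k x).1 * A'.1 (split j l y).2 (split i k x).2),
      Fintype.sum_prod_type]
    have h : ∀ y : Fin j → Bool, ∑ z : Fin l → Bool,
        A.1 (split j l (Fin.appendEquiv j l (y, z))).1 (split i k x).1 *
          A'.1 (split j l (Fin.appendEquiv j l (y, z))).2 (split i k x).2 =
        A.1 y (split i k x).1 := by
      intro y
      have h1 : ∀ z : Fin l → Bool, split j l (Fin.appendEquiv j l (y, z)) = (y, z) := by
        intro z
        simp [split, Fin.appendEquiv]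
      simp only [h1]
      rw [← MetricSemiring.mul_sum_of_nonempty _ Finset.univ_nonempty, A'.2, mul_one]
    simp only [h]
    exact A.2 _⟩

/-- The `0`-`1`-matrix of a function of Boolean vectors: the column of `x` has its `1` in the row
of `f x`. -/
def ofFun (f : (Fin i → Bool) → (Fin j → Bool)) : StochMatrix R i j :=
  ⟨Matrix.of fun y x => if y = f x then 1 else 0, by
    intro x
    simp⟩

end StochMatrix

end BoolStoch

/-- The channel category `BoolStoch_R` of Boolean-indexed stochastic matrices. -/
def boolStoch (R : Type v) [MetricSemiring R] : ChannelStructure.{v} where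
  Channel i j := StochMatrix R i j
  comp := StochMatrix.comp
  tensor := StochMatrix.tensor
  id i := ⟨1, fun x => by simp [Matrix.one_apply]⟩
  swap i j := StochMatrix.ofFun (fun x a => x (finAddFlip a))
  copy := StochMatrix.ofFun (fun x _ => x 0)
  del := ⟨Matrix.of fun _ _ => 1, fun x => by simp⟩

/-! ## Attack trees -/

/-- The function symbols of attack trees over `B`: gates `AND_i` and `OR_i` for `i ≥ 1`, and the
basic attack step labels. -/
inductive ATSymbol (B : Type u) : Type u
  | and (i : ℕ+) : ATSymbol B
  | or (i : ℕ+) : ATSymbol B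
  | bas (b : B) : ATSymbol B

/-- The signature of attack trees over `B`. -/
def attackSignature (B : Type u) : Signature.{u} where
  Symbol := ATSymbol B
  arity
    | .and i => i
    | .or i => i
    | .bas _ => 0

/-- An attack tree component over `B`. -/
abbrev AttackComponent (B : Type u) (i j : ℕ) := TermGraph (attackSignature B) i j

/-- An attack tree over `B`: a term graph without inputs and with one output. -/
abbrev AttackTree (B : Type u) := AttackComponent B 0 1

/-- The stochastic matrix interpretation: `AND_i` and `OR_i` are the `0`-`1`-matrices of
conjunction and disjunction, and `b` is the column `(α₀ b, α₁ b)`. -/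
def stochInterpretation {B : Type u} {R : Type v} [MetricSemiring R] (α₀ α₁ : B → R)
    (hα : ∀ b, α₀ b + α₁ b = 1) : Interpretation (attackSignature B) (boolStoch R)
  | .and i => (StochMatrix.ofFun fun x _ => decide (∀ a, x a = true) : StochMatrix R i 1)
  | .or i => (StochMatrix.ofFun fun x _ => decide (∃ a, x a = true) : StochMatrix R i 1)
  | .bas b => (⟨Matrix.of fun y _ => if y 0 = true then α₁ b else α₀ b, by
      intro x
      rw [← (Equiv.funUnique (Fin 1) Bool).symm.sum_comp]
      simp [add_comm, ← hα b]⟩ : StochMatrix R 0 1)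

namespace AttackComponent

variable {B : Type u} {i j : ℕ}

/-- The set of basic attack steps: the nodes labelled by an element of `B`. -/
def BAS (T : AttackComponent B i j) : Type := {n : T.NonInput // ∃ b, T.label n = ATSymbol.bas b}

instance (T : AttackComponent B i j) : Finite T.BAS :=
  inferInstanceAs (Finite {n : T.NonInput // ∃ b, T.label n = ATSymbol.bas b})

noncomputable instance (T : AttackComponent B i j) : Fintype T.BAS := Fintype.ofFinite _

/-- The label, in `B`, of a basic attack step. -/
noncomputable def basLabel (T : AttackComponent B i j) (v : T.BAS) : B := v.2.choose

theorem label_eq_basLabel (T : AttackComponent B i j) (v : T.BAS) :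
    T.label v.1 = ATSymbol.bas (T.basLabel v) := v.2.choose_spec

/-- An attack tells for each basic attack step whether it is performed. -/
abbrev Attack (T : AttackComponent B i j) : Type := T.BAS → Bool

noncomputable instance (T : AttackComponent B i j) : Fintype T.Attack := Fintype.ofFinite _

open Classical in
/-- The value `S_T(a, x; n)` of the structure function at the node `n`, by recursion along the
acyclic graph `T`. Its defining equations are the four lemmas below. -/
noncomputable def nodeValue (T : AttackComponent B i j) (a : T.Attack) (x : Fin i → Bool) :
    T.Node → Bool :=
  T.wellFounded_child.fix fun n rec =>
    if h : n ∈ Set.range T.inputs then x h.choose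
    else
      match hl : T.label ⟨n, h⟩ with
      | .bas b => a ⟨⟨n, h⟩, b, hl⟩
      | .and _ => decide (∀ m (hm : m ∈ T.children ⟨n, h⟩), rec m ⟨h, hm⟩ = true)
      | .or _ => decide (∃ m, ∃ hm : m ∈ T.children ⟨n, h⟩, rec m ⟨h, hm⟩ = true)

theorem nodeValue_inputs (T : AttackComponent B i j) (a : T.Attack) (x : Fin i → Bool)
    (c : Fin i) : T.nodeValue a x (T.inputs c) = x c := by
  have h : T.inputs c ∈ Set.range T.inputs := ⟨c, rfl⟩
  rw [nodeValue, WellFounded.fix_eq, dif_pos h, T.inputs_injective h.choose_spec]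

theorem nodeValue_bas (T : AttackComponent B i j) (a : T.Attack) (x : Fin i → Bool)
    (v : T.BAS) : T.nodeValue a x v.1.1 = a v := by
  obtain ⟨⟨n, h⟩, b, hb⟩ := v
  rw [nodeValue, WellFounded.fix_eq]
  simp only [dif_neg h]
  split <;> simp_all

theorem nodeValue_and (T : AttackComponent B i j) (a : T.Attack) (x : Fin i → Bool)
    (n : T.NonInput) (k : ℕ+) (hn : T.label n = ATSymbol.and k) :
    T.nodeValue a x n.1 = (T.children n).all (T.nodeValue a x) := by
  obtain ⟨n, h⟩ := n
  rw [nodeValue, WellFounded.fix_eq]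
  simp only [dif_neg h]
  rw [Bool.eq_iff_iff, List.all_eq_true]
  split <;> simp_all

theorem nodeValue_or (T : AttackComponent B i j) (a : T.Attack) (x : Fin i → Bool)
    (n : T.NonInput) (k : ℕ+) (hn : T.label n = ATSymbol.or k) :
    T.nodeValue a x n.1 = (T.children n).any (T.nodeValue a x) := by
  obtain ⟨n, h⟩ := n
  rw [nodeValue, WellFounded.fix_eq]
  simp only [dif_neg h]
  rw [Bool.eq_iff_iff, List.any_eq_true]
  split <;> simp_all

/-- The structure function `S_T : Attacks(T) × {0,1}^i → {0,1}^j`. -/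
noncomputable def structureFunction (T : AttackComponent B i j) (a : T.Attack)
    (x : Fin i → Bool) : Fin j → Bool :=
  fun c => T.nodeValue a x (T.outputs c)

/-- The set of successful attacks on an attack tree. -/
noncomputable def successful (T : AttackTree B) : Finset (Attack T) :=
  Finset.univ.filter fun a => structureFunction T a ![] = ![true]

end AttackComponent

end ChannelSemantics

open ChannelSemantics

/-!
The semantics of a term graph is a state sum. Given an interpretation of the symbols by matrices,
the entry of the matrix of `T` at `(y, x)` is the sum, over all Boolean assignments of the nodes
that restrict to `x` on the inputs and to `y` on the outputs, of the product over the non-input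
nodes of the entries of the matrices of their labels (`TermGraph.stateSum`). Over a commutative
semiring, splitting the assignments of a composite into assignments of its parts shows that the
state sum turns sequential composition into the matrix product and parallel composition into the
Kronecker product (`TermGraph.stateSum_comp`, `TermGraph.stateSum_tensor`), and its values on
wirings and symbols are immediate.

The coefficients `R` need not satisfy `0 * r = 0`. But every summand `r` of `1` does:
if `r + s = 1` then `0 * r + 0 * s = 0`, and `0 * r` is additively idempotent, so it vanishes. The
elements with `0 * r = 0` form a commutative semiring `Annihilated R` that contains all the entries
of stochastic matrices, and the state sums are formed there.

Term graphs are generated by the symbols, the wirings and the two compositions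
(`IsSubchannel.mem`): a non-input node all of whose children are inputs exists by acyclicity, and
splitting it off as a layer turns it into an input of the remaining graph. All wirings are obtained
from identities, swaps, copies and deletions. Generation is used twice: it shows that the columns
of a state sum add up to `1`, so that the state sum is a functor to stochastic matrices
(`semantics`), and that a functor is determined by its values on the symbols
(`ChannelFunctor.Extends.unique`).

For an attack tree, the matrices of the gates have entries `0` and `1`, so that the assignments of
nonzero weight are those given by the structure function for an attack
(`eq_gateValue_of_weight_ne_zero`). The weight of such an assignment is the product over the basic
attack steps of the values of `α₁` or `α₀` at their labels (`weight_gateValue`), and the requirement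
that the output be `1` selects the successful attacks.
-/

namespace ChannelSemantics

universe u v w

/-! ### The elements annihilated by zero -/

section Annihilated

variable {R : Type v} [MetricSemiring R]

theorem MetricSemiring.add_mul (r s t : R) : (r + s) * t = r * t + s * t := by
  rw [mul_comm, MetricSemiring.mul_add, mul_comm t, mul_comm t]

theorem MetricSemiring.zero_mul_zero : (0 : R) * 0 = 0 := by
  have h := MetricSemiring.mul_add (0 : R) 1 0
  rwa [add_zero, mul_one, zero_add, eq_comm] at h

/-- A summand `r` of `1` is annihilated by `0`: the element `0 * r` is additively idempotent and
has an additive inverse. -/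
theorem MetricSemiring.zero_mul_of_add_eq_one {r s : R} (h : r + s = 1) : 0 * r = 0 := by
  have h1 : (0 : R) * r + 0 * s = 0 := by rw [← MetricSemiring.mul_add, h, mul_one]
  have h2 : (0 : R) * r + 0 * r = 0 * r := by rw [← MetricSemiring.add_mul, add_zero]
  calc (0 : R) * r = 0 * r + (0 * r + 0 * s) := by rw [h1, add_zero]
    _ = 0 := by rw [← add_assoc, h2, h1]

theorem IsStochastic.zero_mul {i j : ℕ} {A : Matrix (Fin j → Bool) (Fin i → Bool) R}
    (hA : IsStochastic A) (y : Fin j → Bool) (x : Fin i → Bool) : 0 * A y x = 0 :=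
  MetricSemiring.zero_mul_of_add_eq_one
    ((Finset.add_sum_erase Finset.univ (fun y => A y x) (Finset.mem_univ y)).trans (hA x))

variable (R) in
/-- The elements `r` of `R` with `0 * r = 0`. They form a commutative semiring in the usual sense,
and it contains all the entries of stochastic matrices. -/
def Annihilated : Type v := {r : R // 0 * r = 0}

namespace Annihilated

theorem ext {r s : Annihilated R} (h : r.1 = s.1) : r = s := Subtype.ext h

instance : Zero (Annihilated R) := ⟨⟨0, MetricSemiring.zero_mul_zero⟩⟩

instance : One (Annihilated R) := ⟨⟨1, mul_one 0⟩⟩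

instance : Add (Annihilated R) :=
  ⟨fun r s => ⟨r.1 + s.1, by rw [MetricSemiring.mul_add, r.2, s.2, add_zero]⟩⟩

instance : Mul (Annihilated R) := ⟨fun r s => ⟨r.1 * s.1, by rw [← mul_assoc, r.2, s.2]⟩⟩

instance : CommSemiring (Annihilated R) where
  nsmul := nsmulRec
  add_assoc r s t := ext (add_assoc r.1 s.1 t.1)
  zero_add r := ext (zero_add r.1)
  add_zero r := ext (add_zero r.1)
  add_comm r s := ext (add_comm r.1 s.1)
  mul_assoc r s t := ext (mul_assoc r.1 s.1 t.1)
  one_mul r := ext (one_mul r.1)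
  mul_one r := ext (mul_one r.1)
  mul_comm r s := ext (mul_comm r.1 s.1)
  left_distrib r s t := ext (MetricSemiring.mul_add r.1 s.1 t.1)
  right_distrib r s t := ext (MetricSemiring.add_mul r.1 s.1 t.1)
  zero_mul r := ext r.2
  mul_zero r := ext ((mul_comm r.1 0).trans r.2)

variable (R) in
/-- The inclusion, as a homomorphism of additive monoids. -/
def addHom : Annihilated R →+ R where
  toFun r := r.1
  map_zero' := rfl
  map_add' _ _ := rfl

variable (R) in
/-- The inclusion, as a homomorphism of multiplicative monoids. -/
def mulHom : Annihilated R →* R where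
  toFun r := r.1
  map_one' := rfl
  map_mul' _ _ := rfl

theorem val_sum {ι : Type*} (s : Finset ι) (f : ι → Annihilated R) :
    (∑ a ∈ s, f a).1 = ∑ a ∈ s, (f a).1 :=
  map_sum (addHom R) f s

theorem val_prod {ι : Type*} (s : Finset ι) (f : ι → Annihilated R) :
    (∏ a ∈ s, f a).1 = ∏ a ∈ s, (f a).1 :=
  map_prod (mulHom R) f s

theorem val_ite (p : Prop) [Decidable p] :
    ((if p then 1 else 0 : Annihilated R)).1 = if p then 1 else 0 := by
  split_ifs <;> rfl

end Annihilated

end Annihilated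

/-! ### The state sum of a term graph -/

namespace TermGraph

theorem map_map_eq {α β γ : Type*} {f : α → β} {g : β → γ} {h : α → γ}
    (H : ∀ a, g (f a) = h a) (t : List α) : (t.map f).map g = t.map h := by
  rw [List.map_map]
  exact List.map_congr_left fun a _ => H a

variable {S : Signature.{u}} {i j k l : ℕ} {Z : Type v}

noncomputable instance (T : TermGraph S i j) : Fintype T.NonInput := Fintype.ofFinite _

open Classical in
/-- The Boolean assignment on all the nodes of `T` that is `x` on the inputs and `t` on the
non-input nodes. -/
noncomputable def extend (T : TermGraph S i j) (x : Fin i → Bool) (t : T.NonInput → Bool)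
    (n : T.Node) : Bool :=
  if h : n ∈ Set.range T.inputs then x h.choose else t ⟨n, h⟩

theorem extend_inputs (T : TermGraph S i j) (x : Fin i → Bool) (t : T.NonInput → Bool)
    (a : Fin i) : T.extend x t (T.inputs a) = x a := by
  have h : T.inputs a ∈ Set.range T.inputs := ⟨a, rfl⟩
  rw [extend, dif_pos h, T.inputs_injective h.choose_spec]

theorem extend_nonInput (T : TermGraph S i j) (x : Fin i → Bool) (t : T.NonInput → Bool)
    (n : T.NonInput) : T.extend x t n.1 = t n := by
  rw [extend, dif_neg n.2]

theorem extend_unique (T : TermGraph S i j) (x : Fin i → Bool) (t : T.NonInput → Bool)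
    {v : T.Node → Bool} (hx : ∀ a, v (T.inputs a) = x a) (ht : ∀ n : T.NonInput, v n.1 = t n) :
    T.extend x t = v := by
  funext n
  by_cases h : n ∈ Set.range T.inputs
  · obtain ⟨a, rfl⟩ := h
    rw [extend_inputs, hx]
  · exact (T.extend_nonInput x t ⟨n, h⟩).trans (ht ⟨n, h⟩).symm

variable [CommSemiring Z]

/-- The weight of an assignment: the product over the non-input nodes `n` of the entries
`κ (label n) (values of the children) (value at n)`. -/
noncomputable def weight (κ : S.Symbol → List Bool → Bool → Z) (T : TermGraph S i j)
    (x : Fin i → Bool) (t : T.NonInput → Bool) : Z :=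
  ∏ n, κ (T.label n) ((T.children n).map (T.extend x t)) (t n)

/-- The values at the outputs. -/
noncomputable def outputValue (T : TermGraph S i j) (x : Fin i → Bool)
    (t : T.NonInput → Bool) : Fin j → Bool :=
  fun c => T.extend x t (T.outputs c)

open Classical in
/-- The state sum of a term graph: the matrix whose entry at `(y, x)` is the sum of the weights of
the assignments that restrict to `x` on the inputs and to `y` on the outputs. The symbols are
interpreted by `κ`, where `κ f l b` is the entry of the matrix of `f` in the column `l` and the
row `b`. -/
noncomputable def stateSum (κ : S.Symbol → List Bool → Bool → Z) (T : TermGraph S i j) :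
    Matrix (Fin j → Bool) (Fin i → Bool) Z :=
  Matrix.of fun y x => ∑ t : T.NonInput → Bool,
    if T.outputValue x t = y then T.weight κ x t else 0

open Classical in
theorem stateSum_apply (κ : S.Symbol → List Bool → Bool → Z) (T : TermGraph S i j)
    (y : Fin j → Bool) (x : Fin i → Bool) : T.stateSum κ y x =
      ∑ t : T.NonInput → Bool, if T.outputValue x t = y then T.weight κ x t else 0 := rfl

/-- The bijection between non-input nodes induced by an isomorphism. -/
def Iso.nonInput {T T' : TermGraph S i j} (e : Iso T T') : T.NonInput ≃ T'.NonInput :=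
  e.toEquiv.subtypeEquiv fun n => not_congr (e.mem_range_iff n).symm

theorem stateSum_congr (κ : S.Symbol → List Bool → Bool → Z) {T T' : TermGraph S i j}
    (e : Iso T T') : T.stateSum κ = T'.stateSum κ := by
  classical
  ext y x
  rw [stateSum_apply, stateSum_apply]
  refine Fintype.sum_equiv (e.nonInput.arrowCongr (Equiv.refl Bool)) _ _ fun t => ?_
  have hext : T.extend x t =
      T'.extend x (e.nonInput.arrowCongr (Equiv.refl Bool) t) ∘ e.toEquiv := by
    refine T.extend_unique x t (fun a => ?_) (fun n => ?_)
    · rw [Function.comp_apply, e.map_inputs, extend_inputs]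
    · refine (T'.extend_nonInput x _ (e.nonInput n)).trans ?_
      simp
  have hout : T.outputValue x t =
      T'.outputValue x (e.nonInput.arrowCongr (Equiv.refl Bool) t) := by
    funext c
    rw [outputValue, outputValue, hext, Function.comp_apply, e.map_outputs]
  have hw : T.weight κ x t = T'.weight κ x (e.nonInput.arrowCongr (Equiv.refl Bool) t) := by
    refine Fintype.prod_equiv e.nonInput _ _ fun n => ?_
    have h' := (e.nonInput n).2
    have h1 : T'.label (e.nonInput n) = T.label n := e.map_label n.1 n.2 h'
    have h2 : T'.children (e.nonInput n) = (T.children n).map e.toEquiv :=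
      e.map_children n.1 n.2 h'
    rw [h1, h2, hext, List.map_map]
    simp
  rw [hout, hw]

/-! ### The state sum of a sequential composite -/

/-- The non-input nodes of a sequential composite. -/
def compNonInput (T : TermGraph S j k) (G : TermGraph S i j) :
    (comp T G).NonInput ≃ G.NonInput ⊕ T.NonInput where
  toFun
    | ⟨Sum.inl n, h⟩ => Sum.inl ⟨n, fun ⟨a, ha⟩ => h ⟨a, congrArg Sum.inl ha⟩⟩
    | ⟨Sum.inr n, _⟩ => Sum.inr n
  invFun
    | Sum.inl n => ⟨Sum.inl n.1, fun ⟨a, ha⟩ => n.2 ⟨a, Sum.inl_injective ha⟩⟩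
    | Sum.inr n => ⟨Sum.inr n, fun ⟨_, ha⟩ => Sum.inl_ne_inr ha⟩
  left_inv := by rintro ⟨n | n, h⟩ <;> rfl
  right_inv := by rintro (n | n) <;> rfl

theorem extend_comp (T : TermGraph S j k) (G : TermGraph S i j) (x : Fin i → Bool)
    (g : G.NonInput → Bool) (t : T.NonInput → Bool) :
    (comp T G).extend x (Sum.elim g t ∘ compNonInput T G) =
      Sum.elim (G.extend x g) t := by
  refine extend_unique _ _ _ (fun a => G.extend_inputs x g a) ?_
  rintro ⟨n | n, h⟩
  · exact G.extend_nonInput x g ⟨n, fun ⟨a, ha⟩ => h ⟨a, congrArg Sum.inl ha⟩⟩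
  · rfl

theorem extend_comp_glue (T : TermGraph S j k) (G : TermGraph S i j) (x : Fin i → Bool)
    (g : G.NonInput → Bool) (t : T.NonInput → Bool) (n : T.Node) :
    (comp T G).extend x (Sum.elim g t ∘ compNonInput T G) (glue T G n) =
      T.extend (G.outputValue x g) t n := by
  rw [extend_comp]
  by_cases h : n ∈ Set.range T.inputs
  · obtain ⟨a, rfl⟩ := h
    rw [glue_inputs, extend_inputs]
    rfl
  · rw [glue_nonInput T G ⟨n, h⟩]
    exact (T.extend_nonInput _ t ⟨n, h⟩).symm

theorem weight_comp (κ : S.Symbol → List Bool → Bool → Z) (T : TermGraph S j k)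
    (G : TermGraph S i j) (x : Fin i → Bool) (g : G.NonInput → Bool) (t : T.NonInput → Bool) :
    (comp T G).weight κ x (Sum.elim g t ∘ compNonInput T G) =
      T.weight κ (G.outputValue x g) t * G.weight κ x g := by
  rw [weight, ← (compNonInput T G).symm.prod_comp, Fintype.prod_sum_type, mul_comm]
  congr 1
  · refine Finset.prod_congr rfl fun n _ => ?_
    exact congrArg (κ (T.label n) · (t n))
      (map_map_eq (fun m => extend_comp_glue T G x g t m) (T.children n))
  · refine Finset.prod_congr rfl fun n _ => ?_
    exact congrArg (κ (G.label n) · (g n))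
      (map_map_eq (fun m => congrFun (extend_comp T G x g t) (Sum.inl m)) (G.children n))

theorem stateSum_comp (κ : S.Symbol → List Bool → Bool → Z) (T : TermGraph S j k)
    (G : TermGraph S i j) : (comp T G).stateSum κ = T.stateSum κ * G.stateSum κ := by
  classical
  ext z x
  have hl : (comp T G).stateSum κ z x = ∑ g : G.NonInput → Bool, ∑ t : T.NonInput → Bool,
      if T.outputValue (G.outputValue x g) t = z then
        T.weight κ (G.outputValue x g) t * G.weight κ x g else 0 := by
    rw [stateSum_apply, ← Fintype.sum_prod_type'
      (fun (g : G.NonInput → Bool) (t : T.NonInput → Bool) =>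
        if T.outputValue (G.outputValue x g) t = z then
          T.weight κ (G.outputValue x g) t * G.weight κ x g else 0)]
    symm
    refine Fintype.sum_equiv ((Equiv.sumArrowEquivProdArrow _ _ _).symm.trans
      ((compNonInput T G).symm.arrowCongr (Equiv.refl Bool))) _ _ ?_
    rintro ⟨g, t⟩
    change _ = if (comp T G).outputValue x (Sum.elim g t ∘ compNonInput T G) = z then
      (comp T G).weight κ x (Sum.elim g t ∘ compNonInput T G) else 0
    have hout : (comp T G).outputValue x (Sum.elim g t ∘ compNonInput T G) =
        T.outputValue (G.outputValue x g) t := by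
      funext c
      exact extend_comp_glue T G x g t (T.outputs c)
    rw [weight_comp, hout]
  -- The intermediate vector of the matrix product is the vector of outputs of `G`.
  have hr : ∀ y, T.stateSum κ z y * G.stateSum κ y x = ∑ g : G.NonInput → Bool,
      if G.outputValue x g = y then T.stateSum κ z y * G.weight κ x g else 0 := by
    intro y
    rw [stateSum_apply κ G, Finset.mul_sum]
    simp only [mul_ite, mul_zero]
  rw [Matrix.mul_apply, Finset.sum_congr rfl fun y _ => hr y, Finset.sum_comm, hl]
  refine Finset.sum_congr rfl fun g _ => ?_
  rw [Finset.sum_ite_eq, if_pos (Finset.mem_univ _), stateSum_apply, Finset.sum_mul]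
  simp only [ite_mul, zero_mul]

/-! ### The state sum of a parallel composite -/

/-- The non-input nodes of a parallel composite. -/
def tensorNonInput (G : TermGraph S i j) (T : TermGraph S k l) :
    (tensor G T).NonInput ≃ G.NonInput ⊕ T.NonInput where
  toFun
    | ⟨Sum.inl n, h⟩ => Sum.inl ⟨n, fun hn => h ((inl_mem_tensorInputs G T n).2 hn)⟩
    | ⟨Sum.inr n, h⟩ => Sum.inr ⟨n, fun hn => h ((inr_mem_tensorInputs G T n).2 hn)⟩
  invFun
    | Sum.inl n => ⟨Sum.inl n.1, fun hn => n.2 ((inl_mem_tensorInputs G T n.1).1 hn)⟩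
    | Sum.inr n => ⟨Sum.inr n.1, fun hn => n.2 ((inr_mem_tensorInputs G T n.1).1 hn)⟩
  left_inv := by rintro ⟨n | n, h⟩ <;> rfl
  right_inv := by rintro (n | n) <;> rfl

theorem extend_tensor (G : TermGraph S i j) (T : TermGraph S k l) (x : Fin (i + k) → Bool)
    (g : G.NonInput → Bool) (t : T.NonInput → Bool) :
    (tensor G T).extend x (Sum.elim g t ∘ tensorNonInput G T) =
      Sum.elim (G.extend (StochMatrix.split i k x).1 g)
        (T.extend (StochMatrix.split i k x).2 t) := by
  refine extend_unique _ _ _ (fun a => ?_) ?_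
  · change Sum.elim _ _ (tensorInputs G T a) = x a
    refine Fin.addCases (fun b => ?_) (fun b => ?_) a
    · rw [tensorInputs, Fin.append_left]
      exact G.extend_inputs _ g b
    · rw [tensorInputs, Fin.append_right]
      exact T.extend_inputs _ t b
  · rintro ⟨n | n, h⟩
    · exact G.extend_nonInput _ g ⟨n, fun hn => h ((inl_mem_tensorInputs G T n).2 hn)⟩
    · exact T.extend_nonInput _ t ⟨n, fun hn => h ((inr_mem_tensorInputs G T n).2 hn)⟩

theorem weight_tensor (κ : S.Symbol → List Bool → Bool → Z) (G : TermGraph S i j)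
    (T : TermGraph S k l) (x : Fin (i + k) → Bool)
    (g : G.NonInput → Bool) (t : T.NonInput → Bool) :
    (tensor G T).weight κ x (Sum.elim g t ∘ tensorNonInput G T) =
      G.weight κ (StochMatrix.split i k x).1 g * T.weight κ (StochMatrix.split i k x).2 t := by
  rw [weight, ← (tensorNonInput G T).symm.prod_comp, Fintype.prod_sum_type]
  congr 1
  · refine Finset.prod_congr rfl fun n _ => ?_
    exact congrArg (κ (G.label n) · (g n))
      (map_map_eq (fun m => congrFun (extend_tensor G T x g t) (Sum.inl m)) (G.children n))
  · refine Finset.prod_congr rfl fun n _ => ?_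
    exact congrArg (κ (T.label n) · (t n))
      (map_map_eq (fun m => congrFun (extend_tensor G T x g t) (Sum.inr m)) (T.children n))

theorem stateSum_tensor (κ : S.Symbol → List Bool → Bool → Z) (G : TermGraph S i j)
    (T : TermGraph S k l) (y : Fin (j + l) → Bool) (x : Fin (i + k) → Bool) :
    (tensor G T).stateSum κ y x =
      G.stateSum κ (StochMatrix.split j l y).1 (StochMatrix.split i k x).1 *
        T.stateSum κ (StochMatrix.split j l y).2 (StochMatrix.split i k x).2 := by
  classical
  simp only [stateSum_apply]
  rw [Fintype.sum_mul_sum, ← Fintype.sum_prod_type']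
  refine (Fintype.sum_equiv ((Equiv.sumArrowEquivProdArrow _ _ _).symm.trans
    ((tensorNonInput G T).symm.arrowCongr (Equiv.refl Bool))) _ _ ?_).symm
  rintro ⟨g, t⟩
  change _ = if (tensor G T).outputValue x (Sum.elim g t ∘ tensorNonInput G T) = y then
    (tensor G T).weight κ x (Sum.elim g t ∘ tensorNonInput G T) else 0
  have hout : (tensor G T).outputValue x (Sum.elim g t ∘ tensorNonInput G T) = y ↔
      G.outputValue (StochMatrix.split i k x).1 g = (StochMatrix.split j l y).1 ∧
        T.outputValue (StochMatrix.split i k x).2 t = (StochMatrix.split j l y).2 := by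
    have hL : ∀ b, (tensor G T).outputValue x (Sum.elim g t ∘ tensorNonInput G T)
        (Fin.castAdd l b) = G.outputValue (StochMatrix.split i k x).1 g b := by
      intro b
      change (tensor G T).extend x _ (tensorOutputs G T _) = _
      rw [extend_tensor, tensorOutputs, Fin.append_left]
      rfl
    have hR : ∀ b, (tensor G T).outputValue x (Sum.elim g t ∘ tensorNonInput G T)
        (Fin.natAdd j b) = T.outputValue (StochMatrix.split i k x).2 t b := by
      intro b
      change (tensor G T).extend x _ (tensorOutputs G T _) = _
      rw [extend_tensor, tensorOutputs, Fin.append_right]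
      rfl
    constructor
    · rintro rfl
      exact ⟨funext fun b => (hL b).symm, funext fun b => (hR b).symm⟩
    · rintro ⟨h1, h2⟩
      funext c
      refine Fin.addCases (fun b => ?_) (fun b => ?_) c
      · exact (hL b).trans (congrFun h1 b)
      · exact (hR b).trans (congrFun h2 b)
  rw [weight_tensor, if_congr hout rfl rfl, ite_and, ite_mul, zero_mul, mul_ite, mul_zero]

/-! ### The state sums of atomic term graphs -/

theorem stateSum_wiring (κ : S.Symbol → List Bool → Bool → Z) (w : Fin j → Fin i)
    (y : Fin j → Bool) (x : Fin i → Bool) :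
    (wiring S w).stateSum κ y x = if y = fun c => x (w c) then 1 else 0 := by
  classical
  have : IsEmpty (wiring S w).NonInput := ⟨fun n => n.2 ⟨n.1, rfl⟩⟩
  rw [stateSum_apply, Fintype.sum_subsingleton _ (fun n => isEmptyElim n), weight,
    Fintype.prod_empty]
  refine if_congr ?_ rfl rfl
  rw [eq_comm]
  refine Eq.congr rfl (funext fun c => ?_)
  exact extend_inputs (wiring S w) x _ (w c)

theorem stateSum_ofSymbol (κ : S.Symbol → List Bool → Bool → Z) (f : S.Symbol)
    (y : Fin 1 → Bool) (x : Fin (S.arity f) → Bool) :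
    (ofSymbol S f).stateSum κ y x = κ f (List.ofFn x) (y 0) := by
  classical
  -- The only node that is summed over is the output, where the value has to be `y 0`.
  let n₀ : (ofSymbol S f).NonInput := ⟨none, by rintro ⟨a, ha⟩; cases ha⟩
  have hn : ∀ n : (ofSymbol S f).NonInput, n = n₀ := by
    rintro ⟨_ | a, h⟩
    · rfl
    · exact (h ⟨a, rfl⟩).elim
  rw [stateSum_apply, Fintype.sum_eq_single (fun _ => y 0)]
  · rw [if_pos, weight, Fintype.prod_eq_single n₀ (fun n h => (h (hn n)).elim)]
    · congr 1
      rw [List.ofFn_eq_map]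
      exact map_map_eq (fun a => extend_inputs (ofSymbol S f) x _ a) _
    · funext c
      rw [Subsingleton.elim c 0]
      exact extend_nonInput (ofSymbol S f) x _ n₀
  · intro t ht
    refine if_neg fun h => ht (funext fun n => ?_)
    rw [hn n, ← h]
    exact (extend_nonInput (ofSymbol S f) x t n₀).symm

end TermGraph

/-! ### Generation of term graphs -/

namespace TermGraph

variable {S : Signature.{u}} {i j k l : ℕ}

/-- To give an isomorphism from a composite `T ∘ G` to `N` it suffices to give maps from the nodes
of `G` and of `T` to those of `N` which agree on the glued nodes, preserve all the structure, and
are jointly bijective. -/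
noncomputable def Iso.ofComp {T : TermGraph S j k} {G : TermGraph S i j} {N : TermGraph S i k}
    (f : G.Node → N.Node) (h : T.Node → N.Node)
    (hglue : ∀ a, h (T.inputs a) = f (G.outputs a))
    (hbij : Function.Bijective (Sum.elim f fun n : T.NonInput => h n.1))
    (hin : ∀ a, f (G.inputs a) = N.inputs a)
    (hout : ∀ a, h (T.outputs a) = N.outputs a)
    (hlabelG : ∀ (n : G.NonInput) (h' : f n.1 ∉ Set.range N.inputs),
      N.label ⟨f n.1, h'⟩ = G.label n)
    (hlabelT : ∀ (n : T.NonInput) (h' : h n.1 ∉ Set.range N.inputs),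
      N.label ⟨h n.1, h'⟩ = T.label n)
    (hchildrenG : ∀ (n : G.NonInput) (h' : f n.1 ∉ Set.range N.inputs),
      N.children ⟨f n.1, h'⟩ = (G.children n).map f)
    (hchildrenT : ∀ (n : T.NonInput) (h' : h n.1 ∉ Set.range N.inputs),
      N.children ⟨h n.1, h'⟩ = (T.children n).map h) : Iso (comp T G) N :=
  have hg : ∀ n, Sum.elim f (fun n : T.NonInput => h n.1) (glue T G n) = h n := by
    intro n
    by_cases hn : n ∈ Set.range T.inputs
    · obtain ⟨a, rfl⟩ := hn
      rw [glue_inputs, hglue]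
      rfl
    · rw [glue_nonInput T G ⟨n, hn⟩]
      rfl
  { toEquiv := Equiv.ofBijective _ hbij
    map_inputs := hin
    map_outputs := fun a => (hg (T.outputs a)).trans (hout a)
    map_label := by
      rintro (n | n) h1 h2
      · exact hlabelG ⟨n, fun ⟨a, ha⟩ => h1 ⟨a, congrArg Sum.inl ha⟩⟩ h2
      · exact hlabelT n h2
    map_children := by
      rintro (n | n) h1 h2
      · refine (hchildrenG ⟨n, fun ⟨a, ha⟩ => h1 ⟨a, congrArg Sum.inl ha⟩⟩ h2).trans ?_
        exact (map_map_eq (f := Sum.inl) (h := f) (fun _ => rfl)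
          (G.children ⟨n, fun ⟨a, ha⟩ => h1 ⟨a, congrArg Sum.inl ha⟩⟩)).symm
      · refine (hchildrenT n h2).trans ?_
        exact (map_map_eq hg _).symm }

theorem not_nonInput_wiring (w : Fin j → Fin i) (n : (wiring S w).NonInput) : False :=
  n.2 ⟨n.1, rfl⟩

/-- Wirings compose contravariantly. -/
noncomputable def wiringComp (w : Fin j → Fin i) (w' : Fin k → Fin j) :
    Iso (comp (wiring S w') (wiring S w)) (wiring S (w ∘ w')) :=
  Iso.ofComp (T := wiring S w') (G := wiring S w) (N := wiring S (w ∘ w')) id w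
    (fun _ => rfl)
    ⟨by
      rintro (a | a) (b | b) h
      · exact congrArg Sum.inl h
      · exact (not_nonInput_wiring _ b).elim
      · exact (not_nonInput_wiring _ a).elim
      · exact (not_nonInput_wiring _ a).elim, fun a => ⟨Sum.inl a, rfl⟩⟩
    (fun _ => rfl) (fun _ => rfl)
    (fun n => (not_nonInput_wiring _ n).elim) (fun n => (not_nonInput_wiring _ n).elim)
    (fun n => (not_nonInput_wiring _ n).elim) (fun n => (not_nonInput_wiring _ n).elim)

/-- The juxtaposition of two maps of finite ordinals. -/
def juxtapose (w : Fin j → Fin i) (w' : Fin l → Fin k) : Fin (j + l) → Fin (i + k) :=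
  Fin.append (fun a => Fin.castAdd k (w a)) (fun a => Fin.natAdd i (w' a))

/-- The parallel composition of wirings is a wiring. -/
def wiringTensor (w : Fin j → Fin i) (w' : Fin l → Fin k) :
    Iso (tensor (wiring S w) (wiring S w')) (wiring S (juxtapose w w')) where
  toEquiv := finSumFinEquiv
  map_inputs a := by
    change finSumFinEquiv (tensorInputs (wiring S w) (wiring S w') a : Fin i ⊕ Fin k) = a
    refine Fin.addCases (fun b => ?_) (fun b => ?_) a
    · rw [tensorInputs, Fin.append_left]
      exact finSumFinEquiv_apply_left b
    · rw [tensorInputs, Fin.append_right]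
      exact finSumFinEquiv_apply_right b
  map_outputs a := by
    change finSumFinEquiv (tensorOutputs (wiring S w) (wiring S w') a : Fin i ⊕ Fin k) =
      juxtapose w w' a
    refine Fin.addCases (fun b => ?_) (fun b => ?_) a
    · rw [tensorOutputs, juxtapose, Fin.append_left, Fin.append_left]
      exact finSumFinEquiv_apply_left (w b)
    · rw [tensorOutputs, juxtapose, Fin.append_right, Fin.append_right]
      exact finSumFinEquiv_apply_right (w' b)
  map_label n _ h' := (h' ⟨finSumFinEquiv n, rfl⟩).elim
  map_children n _ h' := (h' ⟨finSumFinEquiv n, rfl⟩).elim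

/-- A term graph without non-input nodes is a wiring. -/
theorem exists_iso_wiring (T : TermGraph S i j) (hT : Function.Surjective T.inputs) :
    ∃ w : Fin j → Fin i, Nonempty (Iso (wiring S w) T) := by
  choose w hw using fun c => hT (T.outputs c)
  exact ⟨w, ⟨{
    toEquiv := Equiv.ofBijective T.inputs ⟨T.inputs_injective, hT⟩
    map_inputs := fun _ => rfl
    map_outputs := hw
    map_label := fun n h => (h ⟨n, rfl⟩).elim
    map_children := fun n h => (h ⟨n, rfl⟩).elim }⟩⟩

theorem range_inputs_subset_range_snoc (T : TermGraph S i j) (n : T.Node) :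
    Set.range T.inputs ⊆ Set.range (Fin.snoc T.inputs n : Fin (i + 1) → T.Node) := by
  rintro _ ⟨a, rfl⟩
  exact ⟨a.castSucc, Fin.snoc_castSucc (α := fun _ => T.Node) n T.inputs a⟩

/-- The term graph obtained from `T` by turning the non-input node `n` into a further input. -/
def promote (T : TermGraph S i j) (n : T.NonInput) : TermGraph S (i + 1) j where
  Node := T.Node
  finite_node := T.finite_node
  inputs := Fin.snoc T.inputs n.1
  outputs := T.outputs
  label m := T.label ⟨m.1, fun h => m.2 (T.range_inputs_subset_range_snoc n.1 h)⟩
  children m := T.children ⟨m.1, fun h => m.2 (T.range_inputs_subset_range_snoc n.1 h)⟩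
  arity_label _ := T.arity_label _
  acyclic m h := T.acyclic m (Relation.TransGen.mono
    (fun _ _ ⟨h, hc⟩ => ⟨fun h' => h (T.range_inputs_subset_range_snoc n.1 h'), hc⟩) m m h)
  inputs_injective := Fin.snoc_injective_of_injective T.inputs_injective n.2

/-- The term graph `i → i + 1` that keeps its `i` inputs and applies `f` to the inputs selected by
`c`. -/
noncomputable def layer (S : Signature.{u}) (i : ℕ) (f : S.Symbol) (c : Fin (S.arity f) → Fin i) :
    TermGraph S i (i + 1) :=
  comp (tensor (wiring S (fun a : Fin i => a)) (ofSymbol S f)) (wiring S (Fin.append id c))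

/-- A node of `T` all of whose children are inputs can be split off as a layer. -/
theorem nonempty_iso_comp_layer (T : TermGraph S i j) (n : T.NonInput)
    (c : Fin (S.arity (T.label n)) → Fin i)
    (hc : T.children n = (List.finRange _).map fun a => T.inputs (c a)) :
    Nonempty (Iso (comp (T.promote n) (layer S i (T.label n) c)) T) := by
  set X := tensor (wiring S (fun a : Fin i => a)) (ofSymbol S (T.label n))
  set W := wiring S (Fin.append id c)
  have hnone : (Sum.inr none : X.Node) ∉ Set.range X.inputs := by
    intro h
    obtain ⟨a, ha⟩ := (inr_mem_tensorInputs _ _ _).1 h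
    cases ha
  -- The only non-input node of `X` is the one labelled by the symbol.
  have huniq : ∀ m : X.NonInput, m = ⟨Sum.inr none, hnone⟩ := by
    rintro ⟨a | _ | a, h⟩
    · exact (h ((inl_mem_tensorInputs _ _ _).2 ⟨a, rfl⟩)).elim
    · rfl
    · exact (h ((inr_mem_tensorInputs _ _ _).2 ⟨a, rfl⟩)).elim
  -- The three cases of the gluing of `X` to the wiring `W`.
  have hgl : ∀ a : Fin i, glue X W (Sum.inl a) = Sum.inl a := by
    intro a
    have h := glue_inputs X W (Fin.castAdd _ a)
    change glue X W (tensorInputs _ _ _) = Sum.inl (Fin.append id c _) at h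
    rwa [tensorInputs, Fin.append_left, Fin.append_left] at h
  have hgr : ∀ a, glue X W (Sum.inr (some a)) = Sum.inl (c a) := by
    intro a
    have h := glue_inputs X W (Fin.natAdd _ a)
    change glue X W (tensorInputs _ _ _) = Sum.inl (Fin.append id c _) at h
    rwa [tensorInputs, Fin.append_right, Fin.append_right] at h
  have hgn : glue X W (Sum.inr none) = Sum.inr ⟨Sum.inr none, hnone⟩ :=
    glue_nonInput X W ⟨Sum.inr none, hnone⟩
  -- The isomorphism sends the inputs of the layer to those of `T`, the symbol node of the layer to
  -- `n`, and is the identity on the nodes of `T.promote n`.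
  let f : (comp X W).Node → T.Node := Sum.elim T.inputs fun _ => n.1
  have hcases : ∀ m : (comp X W).NonInput, m.1 = Sum.inr ⟨Sum.inr none, hnone⟩ := by
    rintro ⟨a | m, h⟩
    · exact (h ⟨a, rfl⟩).elim
    · exact congrArg Sum.inr (huniq m)
  have hlast : (Fin.snoc T.inputs n.1 : Fin (i + 1) → T.Node) (Fin.last i) = n.1 :=
    Fin.snoc_last (α := fun _ => T.Node) _ _
  refine ⟨Iso.ofComp (T := T.promote n) (G := comp X W) f id ?_ ⟨?_, ?_⟩ (fun _ => rfl)
    (fun _ => rfl) ?_ (fun _ _ => rfl) ?_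
    (fun m _ => (List.map_id ((T.promote n).children m)).symm)⟩
  · intro a
    change (Fin.snoc T.inputs n.1 : Fin (i + 1) → T.Node) a = f (glue X W (tensorOutputs _ _ a))
    refine Fin.addCases (fun b => ?_) (fun b => ?_) a
    · rw [tensorOutputs, Fin.append_left]
      refine (Fin.snoc_castSucc (α := fun _ => T.Node) n.1 T.inputs b).trans ?_
      exact (congrArg f (hgl b)).symm
    · rw [tensorOutputs, Fin.append_right, Subsingleton.elim b 0]
      exact hlast.trans (congrArg f hgn).symm
  · rintro ((a | m) | m) ((b | m') | m') h
    · rw [T.inputs_injective h]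
    · exact (n.2 ⟨a, h⟩).elim
    · exact (m'.2 (T.range_inputs_subset_range_snoc n.1 ⟨a, h⟩)).elim
    · exact (n.2 ⟨b, h.symm⟩).elim
    · rw [huniq m, huniq m']
    · exact (m'.2 ⟨Fin.last i, hlast.trans h⟩).elim
    · exact (m.2 (T.range_inputs_subset_range_snoc n.1 ⟨b, h.symm⟩)).elim
    · exact (m.2 ⟨Fin.last i, hlast.trans h.symm⟩).elim
    · exact congrArg Sum.inr (Subtype.ext h)
  · intro m
    by_cases h1 : m ∈ Set.range T.inputs
    · obtain ⟨a, rfl⟩ := h1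
      exact ⟨Sum.inl (Sum.inl a), rfl⟩
    by_cases h2 : m = n.1
    · exact ⟨Sum.inl (Sum.inr ⟨Sum.inr none, hnone⟩), h2.symm⟩
    · refine ⟨Sum.inr ⟨m, ?_⟩, rfl⟩
      rintro ⟨a, ha⟩
      change (Fin.snoc T.inputs n.1 : Fin (i + 1) → T.Node) a = m at ha
      refine Fin.lastCases (fun ha => ?_) (fun b ha => ?_) a ha
      · exact h2 (ha.symm.trans hlast)
      · rw [Fin.snoc_castSucc (α := fun _ => T.Node)] at ha
        exact h1 ⟨b, ha⟩
  · rintro ⟨m, hm⟩ h'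
    obtain rfl : m = _ := hcases ⟨m, hm⟩
    rfl
  · rintro ⟨m, hm⟩ h'
    obtain rfl : m = _ := hcases ⟨m, hm⟩
    have h0 : ((List.finRange (S.arity (T.label n))).map some).map
        (fun a => (Sum.inr a : X.Node)) =
          (List.finRange (S.arity (T.label n))).map fun a => (Sum.inr (some a) : X.Node) :=
      map_map_eq (fun _ => rfl) _
    have h1 := (congrArg (List.map (glue X W)) h0).trans (map_map_eq hgr _)
    have h2 := (congrArg (List.map f) h1).trans
      (map_map_eq (f := fun a => Sum.inl (c a)) (g := f) (h := fun a => T.inputs (c a))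
      (fun _ => rfl) _)
    exact hc.trans h2.symm

/-- In a term graph with a non-input node there is one all of whose children are inputs. -/
theorem exists_children_inputs (T : TermGraph S i j) (hT : ¬ Function.Surjective T.inputs) :
    ∃ (n : T.NonInput) (c : Fin (S.arity (T.label n)) → Fin i),
      T.children n = (List.finRange _).map fun a => T.inputs (c a) := by
  have hne : {n : T.Node | n ∉ Set.range T.inputs}.Nonempty := by
    by_contra h
    rw [Set.not_nonempty_iff_eq_empty] at h
    refine hT fun n => ?_
    by_contra hn
    exact (h ▸ (show n ∈ {n : T.Node | n ∉ Set.range T.inputs} from hn) : n ∈ (∅ : Set T.Node))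
  obtain ⟨n, hn, hmin⟩ := T.wellFounded_child.has_min _ hne
  have hch : ∀ m ∈ T.children ⟨n, hn⟩, m ∈ Set.range T.inputs := by
    intro m hm
    by_contra h
    exact hmin m h ⟨hn, hm⟩
  have hlen := T.arity_label ⟨n, hn⟩
  choose c hc using fun a : Fin (S.arity (T.label ⟨n, hn⟩)) =>
    hch ((T.children ⟨n, hn⟩).get (a.cast hlen)) (List.get_mem _ _)
  refine ⟨⟨n, hn⟩, c, ?_⟩
  refine List.ext_get (by simp [hlen]) fun a h1 h2 => ?_
  simp [hc]

end TermGraph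

open TermGraph

section Generation

variable {S : Signature.{u}}

/-- The class, in the channel category of term graphs, of a term graph. -/
def TermGraph.toChannel {i j : ℕ} (T : TermGraph S i j) : (termGraphs S).Channel i j :=
  Quotient.mk (isoSetoid S i j) T

theorem TermGraph.toChannel_eq {i j : ℕ} {T T' : TermGraph S i j} (e : Iso T T') :
    T.toChannel = T'.toChannel :=
  Quotient.sound ⟨e⟩

/-- A family of sets of term graphs (up to isomorphism) that contains the identity, swap, copy and
delete graphs and is closed under both compositions. -/
structure IsSubchannel (P : ∀ {i j : ℕ}, (termGraphs S).Channel i j → Prop) : Prop where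
  comp : ∀ {i j k : ℕ} (g : (termGraphs S).Channel j k) (f : (termGraphs S).Channel i j),
    P g → P f → P ((termGraphs S).comp g f)
  tensor : ∀ {i j k l : ℕ} (g : (termGraphs S).Channel i j) (f : (termGraphs S).Channel k l),
    P g → P f → P ((termGraphs S).tensor g f)
  id : ∀ i, P ((termGraphs S).id i)
  swap : ∀ i j, P ((termGraphs S).swap i j)
  copy : P (termGraphs S).copy
  del : P (termGraphs S).del

namespace IsSubchannel

variable {P : ∀ {i j : ℕ}, (termGraphs S).Channel i j → Prop}

theorem wiring_comp (hP : IsSubchannel P) {i j k : ℕ} {w : Fin j → Fin i} {w' : Fin k → Fin j}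
    (h : P (toChannel (wiring S w))) (h' : P (toChannel (wiring S w'))) :
    P (toChannel (wiring S (w ∘ w'))) := by
  rw [← toChannel_eq (wiringComp w w')]
  exact hP.comp _ _ h' h

/-- Closure under juxtaposition, for a map `u` whose domain and codomain are sums only up to
propositional equality and which is given by its values. -/
theorem wiring_juxtapose (hP : IsSubchannel P) {i j k l m n : ℕ} {w : Fin j → Fin i}
    {w' : Fin l → Fin k}
    (h : P (toChannel (wiring S w))) (h' : P (toChannel (wiring S w'))) (u : Fin m → Fin n)
    (hm : m = j + l) (hn : n = i + k)
    (hl : ∀ (a : Fin m) (ha : a.1 < j), (u a).1 = w ⟨a, ha⟩)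
    (hr : ∀ (a : Fin l) (ha : j + a.1 < m), (u ⟨j + a, ha⟩).1 = i + w' a) :
    P (toChannel (wiring S u)) := by
  subst hm hn
  have hu : u = juxtapose w w' := by
    funext a
    refine Fin.addCases (fun b => ?_) (fun b => ?_) a
    · rw [juxtapose, Fin.append_left]
      exact Fin.ext (hl _ b.2)
    · rw [juxtapose, Fin.append_right]
      exact Fin.ext (hr b _)
  rw [hu, ← toChannel_eq (wiringTensor w w')]
  exact hP.tensor _ _ h h'

theorem wiring_id (hP : IsSubchannel P) (i : ℕ) :
    P (toChannel (wiring S (fun a : Fin i => a))) := hP.id i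

theorem wiring_del (hP : IsSubchannel P) (i : ℕ) (w : Fin 0 → Fin i) :
    P (toChannel (wiring S w)) := by
  induction i with
  | zero =>
    have h : w = fun a => a := funext fun a => a.elim0
    rw [h]
    exact hP.id 0
  | succ i ih =>
    exact hP.wiring_juxtapose (ih Fin.elim0) hP.del w rfl rfl (fun a => a.elim0) (fun a => a.elim0)

/-- The wiring that selects a single wire. -/
theorem wiring_single (hP : IsSubchannel P) {i : ℕ} (w : Fin 1 → Fin i) :
    P (toChannel (wiring S w)) := by
  -- The wires before and after the selected one are deleted.
  have h1 := hP.wiring_juxtapose (hP.wiring_del (w 0).1 Fin.elim0) (hP.wiring_id 1)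
    (fun _ : Fin 1 => Fin.last (w 0).1) rfl rfl
    (fun a ha => absurd ha (Nat.not_lt_zero _)) (fun a _ => by simp)
  refine hP.wiring_juxtapose h1 (hP.wiring_del (i - (w 0).1 - 1) Fin.elim0) w rfl (by omega)
    (fun a _ => by rw [Subsingleton.elim a 0]; simp) (fun a => a.elim0)

/-- The wiring that duplicates a list of wires. -/
theorem wiring_copy (hP : IsSubchannel P) (i : ℕ) :
    P (toChannel (wiring S (Fin.append (fun a : Fin i => a) (fun a : Fin i => a)))) := by
  induction i with
  | zero => exact hP.wiring_del 0 _
  | succ i ih =>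
    -- The copies of the last wire have to be moved from the end to the positions `i` and
    -- `2 * i + 1`.
    -- Here `w` is the juxtaposition of the two duplications, `p` is the permutation that moves the
    -- wires, and `q` is the part of `p` without the last wire.
    let w : Fin ((i + i) + 2) → Fin (i + 1) := fun a =>
      if h : a.1 < i then ⟨a, by omega⟩ else
      if h : a.1 < i + i then ⟨a - i, by omega⟩ else Fin.last i
    have hw : P (toChannel (wiring S w)) := by
      refine hP.wiring_juxtapose ih hP.copy w rfl rfl (fun a ha => ?_) (fun a ha => ?_)
      · by_cases h : a.1 < i
        · have := Fin.append_left (fun a : Fin i => a) (fun a : Fin i => a) ⟨a, h⟩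
          simp only [Fin.castAdd_mk] at this
          rw [this]
          simp [w, h]
        · have := Fin.append_right (fun a : Fin i => a) (fun a : Fin i => a) ⟨a - i, by omega⟩
          simp only [Fin.natAdd_mk, Nat.add_sub_cancel' (not_lt.1 h)] at this
          rw [this]
          simp [w, h, ha]
      · have h1 : ¬ i + i + a.1 < i := by omega
        simp [w, h1]
    have hwv : ∀ a, (w a).1 = if a.1 < i then a.1 else if a.1 < i + i then a.1 - i else i := by
      intro a
      simp only [w]
      split_ifs <;> rfl
    let q : Fin (i + (1 + i)) → Fin (i + (i + 1)) := fun a =>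
      if h : a.1 < i then ⟨a, by omega⟩ else
      if h : a.1 = i then ⟨i + i, by omega⟩ else ⟨a - 1, by omega⟩
    have hq : P (toChannel (wiring S q)) := by
      refine hP.wiring_juxtapose (hP.wiring_id i) (hP.swap i 1) q rfl rfl (fun a ha => ?_)
        (fun a ha => ?_)
      · simp [q, ha]
      · refine Fin.addCases (fun b _ => ?_) (fun b _ => ?_) a ha
        · simp [q, finAddFlip_apply_castAdd]
        · simp [q, finAddFlip_apply_natAdd]
          omega
    let p : Fin ((i + 1) + (i + 1)) → Fin ((i + i) + 2) := fun a =>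
      if h : a.1 < i then ⟨a, by omega⟩ else
      if h : a.1 = i then ⟨i + i, by omega⟩ else
      if h : a.1 < i + (1 + i) then ⟨a - 1, by omega⟩ else ⟨i + i + 1, by omega⟩
    have hpv : ∀ a, (p a).1 = if a.1 < i then a.1 else if a.1 = i then i + i else
        if a.1 < i + (1 + i) then a.1 - 1 else i + i + 1 := by
      intro a
      simp only [p]
      split_ifs <;> rfl
    have hp : P (toChannel (wiring S p)) := by
      refine hP.wiring_juxtapose hq (hP.wiring_id 1) p (by omega) (by omega) (fun a ha => ?_)
        (fun a ha => ?_)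
      · simp only [p, q]
        split_ifs <;> simp
      · have : a.1 = 0 := by omega
        rw [hpv]
        simp only [Fin.val_eq_zero, add_zero]
        split_ifs <;> omega
    have h := hP.wiring_comp hw hp
    convert h using 3
    funext a
    refine Fin.ext ?_
    refine Fin.addCases (fun b => ?_) (fun b => ?_) a
    · rw [Fin.append_left]
      change b.1 = (w (p _)).1
      rw [hwv, hpv, Fin.val_castAdd]
      split_ifs <;> omega
    · rw [Fin.append_right]
      change b.1 = (w (p _)).1
      rw [hwv, hpv, Fin.val_natAdd]
      split_ifs <;> omega

theorem wiring_append (hP : IsSubchannel P) {i j k : ℕ} {w : Fin j → Fin i} {w' : Fin k → Fin i}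
    (h : P (toChannel (wiring S w))) (h' : P (toChannel (wiring S w'))) :
    P (toChannel (wiring S (Fin.append w w'))) := by
  have h1 : P (toChannel (wiring S (juxtapose w w'))) := by
    rw [← toChannel_eq (wiringTensor w w')]
    exact hP.tensor _ _ h h'
  have h2 := hP.wiring_comp (hP.wiring_copy i) h1
  convert h2 using 3
  funext a
  refine Fin.addCases (fun b => ?_) (fun b => ?_) a
  · rw [Function.comp_apply, juxtapose, Fin.append_left, Fin.append_left, Fin.append_left]
  · rw [Function.comp_apply, juxtapose, Fin.append_right, Fin.append_right, Fin.append_right]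

/-- Every wiring lies in a subchannel: its outputs are selected one by one. -/
theorem wiring_mem (hP : IsSubchannel P) {i j : ℕ} (w : Fin j → Fin i) :
    P (toChannel (wiring S w)) := by
  induction j with
  | zero => exact hP.wiring_del i w
  | succ j ih =>
    have h := hP.wiring_append (ih fun a => w a.castSucc) (hP.wiring_single fun _ => w (Fin.last j))
    convert h using 3
    funext a
    refine Fin.addCases (fun b => ?_) (fun b => ?_) a
    · rw [Fin.append_left]
      rfl
    · rw [Fin.append_right, Subsingleton.elim b 0]
      rfl

/-- Term graphs are generated by the symbols: nodes are split off one by one, each time one all of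
whose children are inputs. -/
theorem mem (hP : IsSubchannel P) (hsymbol : ∀ f : S.Symbol, P (toChannel (ofSymbol S f)))
    {i j : ℕ} (X : (termGraphs S).Channel i j) : P X := by
  obtain ⟨T, rfl⟩ := Quotient.exists_rep X
  obtain ⟨m, hm⟩ : ∃ m, Nat.card T.Node = i + m := by
    have h := Nat.card_le_card_of_injective T.inputs T.inputs_injective
    rw [Nat.card_fin] at h
    exact Nat.exists_eq_add_of_le h
  change P T.toChannel
  induction m generalizing i with
  | zero =>
    have hT : Function.Surjective T.inputs :=
      ((Nat.bijective_iff_injective_and_card T.inputs).2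
        ⟨T.inputs_injective, by rw [hm, Nat.card_fin, add_zero]⟩).2
    obtain ⟨w, ⟨e⟩⟩ := T.exists_iso_wiring hT
    rw [← toChannel_eq e]
    exact hP.wiring_mem w
  | succ m ih =>
    -- `T.promote n` has the nodes of `T` and one more input, so `m` decreases.
    have hT : ¬ Function.Surjective T.inputs := by
      intro h
      have h1 := Nat.card_le_card_of_surjective T.inputs h
      rw [Nat.card_fin] at h1
      omega
    obtain ⟨n, c, hc⟩ := T.exists_children_inputs hT
    obtain ⟨e⟩ := T.nonempty_iso_comp_layer n c hc
    rw [← toChannel_eq e]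
    exact hP.comp (T.promote n).toChannel (layer S i _ c).toChannel
      (ih (T.promote n) (hm.trans (by omega)))
      (hP.comp (TermGraph.tensor (wiring S fun a : Fin i => a) (ofSymbol S _)).toChannel
        (wiring S (Fin.append _root_.id c)).toChannel
        (hP.tensor (wiring S fun a : Fin i => a).toChannel (ofSymbol S _).toChannel (hP.id i)
          (hsymbol _)) (hP.wiring_mem _))

end IsSubchannel

end Generation

/-! ### The semantics given by an interpretation -/

section Semantics

variable {S : Signature.{u}} {R : Type v} [MetricSemiring R]

/-- The matrix of a symbol under an interpretation. -/
def symbolMatrix (I : Interpretation S (boolStoch R)) (f : S.Symbol) :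
    StochMatrix R (S.arity f) 1 :=
  I f

/-- The entries of the matrices of an interpretation, as a function of the symbol, the list of the
values of the arguments, and the value. On lists whose length is not the arity it is `0`. -/
noncomputable def kernel (I : Interpretation S (boolStoch R)) (f : S.Symbol) (l : List Bool)
    (b : Bool) : Annihilated R :=
  if h : l.length = S.arity f then
    ⟨(symbolMatrix I f).1 (fun _ => b) (fun a => l.get (a.cast h.symm)),
      (symbolMatrix I f).2.zero_mul _ _⟩
  else 0

theorem val_kernel (I : Interpretation S (boolStoch R)) (f : S.Symbol) (l : List Bool)
    (h : l.length = S.arity f) (b : Bool) : (kernel I f l b).1 =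
      (symbolMatrix I f).1 (fun _ => b) (fun a => l.get (a.cast h.symm)) :=
  congrArg Subtype.val (dif_pos h)

theorem val_kernel_ofFn (I : Interpretation S (boolStoch R)) (f : S.Symbol)
    (x : Fin (S.arity f) → Bool) (b : Bool) :
    (kernel I f (List.ofFn x) b).1 = (symbolMatrix I f).1 (fun _ => b) x := by
  rw [val_kernel I f _ List.length_ofFn]
  simp

/-- The state sum on isomorphism classes of term graphs. -/
noncomputable def stateSumQuotient (κ : S.Symbol → List Bool → Bool → Annihilated R) {i j : ℕ} :
    (termGraphs S).Channel i j → Matrix (Fin j → Bool) (Fin i → Bool) (Annihilated R) :=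
  Quotient.lift (stateSum κ) fun _ _ ⟨e⟩ => stateSum_congr κ e

/-- The state sum is stochastic because it is so for the generators, and compositions of stochastic
matrices are stochastic. -/
theorem sum_stateSumQuotient (I : Interpretation S (boolStoch R)) {i j : ℕ}
    (X : (termGraphs S).Channel i j) (x : Fin i → Bool) :
    ∑ y, stateSumQuotient (kernel I) X y x = 1 := by
  -- All four wiring generators have the state sum of a function, with one `1` in each column.
  have hw : ∀ {i j : ℕ} (w : Fin j → Fin i) (x : Fin i → Bool),
      ∑ y, (wiring S w).stateSum (kernel I) y x = 1 := by
    intro i j w x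
    simp only [stateSum_wiring]
    rw [Finset.sum_ite_eq', if_pos (Finset.mem_univ _)]
  have hP : IsSubchannel (S := S) (fun {i j} X => ∀ x : Fin i → Bool,
      ∑ y : Fin j → Bool, stateSumQuotient (kernel I) X y x = 1) := by
    refine ⟨?_, ?_, fun i => hw _, fun i j => hw _, hw _, hw _⟩
    · intro i j k g f
      refine Quotient.inductionOn₂ g f fun T G hT hG x => ?_
      change ∑ y, (comp T G).stateSum (kernel I) y x = 1
      simp only [stateSum_comp, Matrix.mul_apply]
      rw [Finset.sum_comm]
      simp only [← Finset.sum_mul]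
      refine Eq.trans (Finset.sum_congr rfl fun z _ => ?_) (hG x)
      exact (congrArg (· * _) (hT z)).trans (one_mul _)
    · intro i j k l g f
      refine Quotient.inductionOn₂ g f fun G T hG hT x => ?_
      change ∑ y, (tensor G T).stateSum (kernel I) y x = 1
      simp only [stateSum_tensor]
      have hs : ∀ y, StochMatrix.split j l (Fin.appendEquiv j l y) = y := by
        rintro ⟨y, z⟩
        simp [StochMatrix.split, Fin.appendEquiv]
      rw [← (Fin.appendEquiv j l).sum_comp]
      simp only [hs]
      rw [Fintype.sum_prod_type]
      simp only [← Finset.mul_sum]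
      refine Eq.trans (Finset.sum_congr rfl fun z _ => ?_) (hG (StochMatrix.split i k x).1)
      exact (congrArg (_ * ·) (hT _)).trans (mul_one _)
  refine hP.mem (fun f x => ?_) X x
  refine Eq.trans (Finset.sum_congr rfl fun y _ => stateSum_ofSymbol (kernel I) f y x)
    (Annihilated.ext ?_)
  rw [Annihilated.val_sum]
  simp only [val_kernel_ofFn]
  refine Eq.trans (Finset.sum_congr rfl fun y _ => ?_) ((symbolMatrix I f).2 x)
  exact congrArg (fun y => (symbolMatrix I f).1 y x)
    (funext fun a => congrArg y (Subsingleton.elim 0 a))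

/-- The functor given by the state sums. -/
noncomputable def semantics (I : Interpretation S (boolStoch R)) :
    ChannelFunctor (termGraphs S) (boolStoch R) where
  map {i j} X := (⟨Matrix.of fun y x => (stateSumQuotient (kernel I) X y x).1, fun x => by
    simp only [Matrix.of_apply]
    rw [← Annihilated.val_sum, sum_stateSumQuotient]
    rfl⟩ : StochMatrix R i j)
  map_comp {i j k} g f := by
    refine Quotient.inductionOn₂ g f fun T G => Subtype.ext (Matrix.ext fun z x => ?_)
    change ((comp T G).stateSum (kernel I) z x).1 = ∑ y, _ * _
    rw [stateSum_comp, Matrix.mul_apply, Annihilated.val_sum]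
    rfl
  map_tensor {i j k l} g f := by
    refine Quotient.inductionOn₂ g f fun G T => Subtype.ext (Matrix.ext fun y x => ?_)
    change ((tensor G T).stateSum (kernel I) y x).1 = _
    rw [stateSum_tensor]
    rfl
  map_id i := by
    refine Subtype.ext (Matrix.ext fun y x => ?_)
    change ((wiring S _).stateSum (kernel I) y x).1 = (1 : Matrix _ _ R) y x
    rw [stateSum_wiring, Annihilated.val_ite, Matrix.one_apply]
  map_swap i j := by
    refine Subtype.ext (Matrix.ext fun y x => ?_)
    change ((wiring S _).stateSum (kernel I) y x).1 = _
    rw [stateSum_wiring, Annihilated.val_ite]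
    rfl
  map_copy := by
    refine Subtype.ext (Matrix.ext fun y x => ?_)
    change ((wiring S _).stateSum (kernel I) y x).1 = _
    rw [stateSum_wiring, Annihilated.val_ite]
    rfl
  map_del := by
    refine Subtype.ext (Matrix.ext fun y x => ?_)
    change ((wiring S _).stateSum (kernel I) y x).1 = _
    rw [stateSum_wiring, Annihilated.val_ite, if_pos (Subsingleton.elim _ _)]
    rfl

theorem semantics_extends (I : Interpretation S (boolStoch R)) : (semantics I).Extends I := by
  intro f
  refine Subtype.ext (Matrix.ext fun y x => ?_)
  change ((ofSymbol S f).stateSum (kernel I) y x).1 = (I f).1 y x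
  rw [stateSum_ofSymbol, val_kernel_ofFn]
  exact congrArg (fun y => (symbolMatrix I f).1 y x)
    (funext fun a => congrArg y (Subsingleton.elim 0 a))

/-- A functor on term graphs is determined by its values on the symbols. -/
theorem ChannelFunctor.Extends.unique {C : ChannelStructure.{w}} {I : Interpretation S C}
    {F G : ChannelFunctor (termGraphs S) C} (hF : F.Extends I) (hG : G.Extends I) : F = G := by
  have hP : IsSubchannel (S := S) (fun X => F.map X = G.map X) := by
    refine ⟨?_, ?_, ?_, ?_, ?_, ?_⟩
    · intro i j k g f hg hf
      rw [F.map_comp, G.map_comp, hg, hf]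
    · intro i j k l g f hg hf
      rw [F.map_tensor, G.map_tensor, hg, hf]
    · intro i
      rw [F.map_id, G.map_id]
    · intro i j
      rw [F.map_swap, G.map_swap]
    · rw [F.map_copy, G.map_copy]
    · rw [F.map_del, G.map_del]
  have h : ∀ {i j : ℕ} (X : (termGraphs S).Channel i j), F.map X = G.map X :=
    hP.mem fun f => (hF f).trans (hG f).symm
  have hmap : @F.map = @G.map := by
    funext i j X
    exact h X
  cases F
  cases G
  cases hmap
  rfl

end Semantics

/-! ### The state sum of an attack tree -/

section AttackTrees

open AttackComponent

variable {B : Type u} {R : Type v} [MetricSemiring R] {α₀ α₁ : B → R} {i j : ℕ}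

/-- By `hα`, both `α₀ b` and `α₁ b` are summands of `1`. -/
theorem attackTerm_zero_mul (hα : ∀ b, α₀ b + α₁ b = 1) (b : B) (c : Bool) :
    0 * (if c = true then α₁ b else α₀ b) = 0 := by
  split_ifs
  · exact MetricSemiring.zero_mul_of_add_eq_one ((add_comm _ _).trans (hα b))
  · exact MetricSemiring.zero_mul_of_add_eq_one (hα b)

/-- The value `α₁ b` or `α₀ b`, depending on whether the attack step is performed. -/
def attackTerm (hα : ∀ b, α₀ b + α₁ b = 1) (b : B) (c : Bool) : Annihilated R :=
  ⟨if c = true then α₁ b else α₀ b, attackTerm_zero_mul hα b c⟩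

theorem kernel_bas (hα : ∀ b, α₀ b + α₁ b = 1) (b : B) (l : List Bool) (hl : l.length = 0)
    (c : Bool) : kernel (stochInterpretation α₀ α₁ hα) (.bas b) l c = attackTerm hα b c :=
  Annihilated.ext (val_kernel (stochInterpretation α₀ α₁ hα) (.bas b) l hl c)

theorem forall_get_cast_iff {p : Bool → Prop} (l : List Bool) {n : ℕ} (hl : l.length = n) :
    (∀ a : Fin n, p (l.get (a.cast hl.symm))) ↔ ∀ b ∈ l, p b := by
  subst hl
  simp [List.forall_mem_iff_get]

theorem kernel_and (hα : ∀ b, α₀ b + α₁ b = 1) (n : ℕ+) (l : List Bool)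
    (hl : l.length = n) (c : Bool) :
    kernel (stochInterpretation α₀ α₁ hα) (.and n) l c = if c = l.all id then 1 else 0 := by
  refine Annihilated.ext ((val_kernel (stochInterpretation α₀ α₁ hα) (.and n) l hl c).trans
    (Eq.trans ?_ (Annihilated.val_ite _).symm))
  refine if_congr ?_ rfl rfl
  rw [funext_iff]
  have h : decide (∀ a : Fin n, l.get (a.cast hl.symm) = true) = l.all id := by
    rw [Bool.eq_iff_iff, decide_eq_true_iff, List.all_eq_true]
    exact forall_get_cast_iff (p := (· = true)) l hl
  rw [← h]
  exact ⟨fun h => h 0, fun h _ => h⟩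

theorem kernel_or (hα : ∀ b, α₀ b + α₁ b = 1) (n : ℕ+) (l : List Bool)
    (hl : l.length = n) (c : Bool) :
    kernel (stochInterpretation α₀ α₁ hα) (.or n) l c = if c = l.any id then 1 else 0 := by
  refine Annihilated.ext ((val_kernel (stochInterpretation α₀ α₁ hα) (.or n) l hl c).trans
    (Eq.trans ?_ (Annihilated.val_ite _).symm))
  refine if_congr ?_ rfl rfl
  rw [funext_iff]
  have h : decide (∃ a : Fin n, l.get (a.cast hl.symm) = true) = l.any id := by
    have h1 := not_congr (forall_get_cast_iff (p := (¬ · = true)) l hl)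
    rw [Bool.eq_iff_iff, decide_eq_true_iff, List.any_eq_true]
    simpa using h1
  rw [← h]
  exact ⟨fun h => h 0, fun h _ => h⟩

/-- The assignment of values to the non-input nodes that is given by the structure function. -/
noncomputable def gateValue (T : AttackComponent B i j) (x : Fin i → Bool) (a : T.Attack)
    (n : T.NonInput) : Bool :=
  T.nodeValue a x n.1

theorem extend_gateValue (T : AttackComponent B i j) (x : Fin i → Bool) (a : T.Attack) :
    T.extend x (gateValue T x a) = T.nodeValue a x :=
  T.extend_unique x _ (T.nodeValue_inputs a x) fun _ => rfl

/-- An assignment of nonzero weight is the one given by the structure function for its restriction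
to the basic attack steps, because every gate forces the value at its node. -/
theorem eq_gateValue_of_weight_ne_zero (hα : ∀ b, α₀ b + α₁ b = 1)
    (T : AttackComponent B i j) (x : Fin i → Bool)
    (t : T.NonInput → Bool) (ht : T.weight (kernel (stochInterpretation α₀ α₁ hα)) x t ≠ 0) :
    t = gateValue T x fun v => t v.1 := by
  have hne : ∀ n : T.NonInput, kernel (stochInterpretation α₀ α₁ hα) (T.label n)
      ((T.children n).map (T.extend x t)) (t n) ≠ 0 :=
    fun n h => ht (Finset.prod_eq_zero (Finset.mem_univ n) h)
  have hlen : ∀ n : T.NonInput, ((T.children n).map (T.extend x t)).length =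
      (attackSignature B).arity (T.label n) := by
    intro n
    rw [List.length_map, T.arity_label]
  -- Induction from the children to the parents.
  have key : ∀ m, T.extend x t m = T.nodeValue (fun v => t v.1) x m := by
    intro m
    induction m using T.wellFounded_child.induction with
    | _ m ih =>
    by_cases hm : m ∈ Set.range T.inputs
    · obtain ⟨a, rfl⟩ := hm
      rw [extend_inputs, nodeValue_inputs]
    have hch : (T.children ⟨m, hm⟩).map (T.extend x t) =
        (T.children ⟨m, hm⟩).map (T.nodeValue (fun v => t v.1) x) :=
      List.map_congr_left fun c hc => ih c ⟨hm, hc⟩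
    have h := hne ⟨m, hm⟩
    have hl := hlen ⟨m, hm⟩
    refine (T.extend_nonInput x t ⟨m, hm⟩).trans ?_
    rcases hlab : T.label ⟨m, hm⟩ with k | k | b
    · rw [hlab] at h hl
      rw [kernel_and hα k _ hl, hch] at h
      refine (by_contra fun h' => h (if_neg h')).trans ?_
      refine Eq.trans ?_ (T.nodeValue_and _ x ⟨m, hm⟩ k hlab).symm
      rw [List.all_map]
      rfl
    · rw [hlab] at h hl
      rw [kernel_or hα k _ hl, hch] at h
      refine (by_contra fun h' => h (if_neg h')).trans ?_
      refine Eq.trans ?_ (T.nodeValue_or _ x ⟨m, hm⟩ k hlab).symm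
      rw [List.any_map]
      rfl
    · exact (T.nodeValue_bas (fun v => t v.1) x ⟨⟨m, hm⟩, b, hlab⟩).symm
  funext n
  exact (T.extend_nonInput x t n).symm.trans (key n.1)

/-- The gates contribute the factor `1` to the weight of the assignment given by the structure
function. -/
theorem weight_gateValue (hα : ∀ b, α₀ b + α₁ b = 1)
    (T : AttackComponent B i j) (x : Fin i → Bool) (a : T.Attack) :
    T.weight (kernel (stochInterpretation α₀ α₁ hα)) x (gateValue T x a) =
      ∏ v : T.BAS, attackTerm hα (T.basLabel v) (a v) := by
  classical
  have hlen : ∀ n : T.NonInput, ((T.children n).map (T.nodeValue a x)).length =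
      (attackSignature B).arity (T.label n) := by
    intro n
    rw [List.length_map, T.arity_label]
  rw [weight, extend_gateValue]
  symm
  refine Finset.prod_of_injOn (fun v : T.BAS => v.1) (fun _ _ _ _ h => Subtype.ext h)
    (fun _ _ => Finset.mem_coe.2 (Finset.mem_univ _)) (fun n _ hn => ?_) (fun v _ => ?_)
  · have hl := hlen n
    rcases hlab : T.label n with k | k | b
    · rw [hlab] at hl
      rw [kernel_and hα k _ hl, if_pos]
      refine (T.nodeValue_and a x n k hlab).trans ?_
      rw [List.all_map]
      rfl
    · rw [hlab] at hl
      rw [kernel_or hα k _ hl, if_pos]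
      refine (T.nodeValue_or a x n k hlab).trans ?_
      rw [List.any_map]
      rfl
    · exact (hn ⟨⟨n, b, hlab⟩, Finset.mem_coe.2 (Finset.mem_univ _), rfl⟩).elim
  · have hl := hlen v.1
    have hlab := T.label_eq_basLabel v
    rw [hlab] at hl
    rw [hlab, kernel_bas hα _ _ hl, gateValue, nodeValue_bas]

theorem val_prod_attackTerm (hα : ∀ b, α₀ b + α₁ b = 1)
    (T : AttackComponent B i j) (a : T.Attack) :
    (∏ v : T.BAS, attackTerm hα (T.basLabel v) (a v)).1 =
      (∏ v : T.BAS with a v = true, α₁ (T.basLabel v)) *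
        ∏ v : T.BAS with a v = false, α₀ (T.basLabel v) := by
  rw [Annihilated.val_prod]
  refine (Finset.prod_ite _ _).trans ?_
  simp only [Bool.not_eq_true]

/-- The assignments of nonzero weight correspond to the attacks. -/
theorem stateSum_attackTree (hα : ∀ b, α₀ b + α₁ b = 1)
    (T : AttackTree B) :
    T.stateSum (kernel (stochInterpretation α₀ α₁ hα)) ![true] ![] =
      ∑ a ∈ successful T, ∏ v : BAS T, attackTerm hα (basLabel T v) (a v) := by
  classical
  rw [stateSum_apply]
  symm
  have hout : ∀ a : Attack T, T.outputValue ![] (gateValue T ![] a) =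
      structureFunction T a ![] := by
    intro a
    funext c
    rw [outputValue, extend_gateValue]
    rfl
  refine Finset.sum_of_injOn (gateValue T ![]) ?_
    (fun _ _ => Finset.mem_coe.2 (Finset.mem_univ _)) (fun t _ ht => ?_) (fun a ha => ?_)
  · intro a _ a' _ h
    funext v
    rw [← nodeValue_bas T a ![] v, ← nodeValue_bas T a' ![] v]
    exact congrFun h v.1
  · by_contra hne
    rw [ite_eq_right_iff, Classical.not_imp] at hne
    have h := eq_gateValue_of_weight_ne_zero hα T ![] t hne.2
    refine ht ⟨fun v => t v.1, ?_, h.symm⟩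
    rw [successful, Finset.mem_coe, Finset.mem_filter]
    refine ⟨Finset.mem_univ _, ?_⟩
    rw [← hout, ← h]
    exact hne.1
  · rw [successful, Finset.mem_filter] at ha
    rw [if_pos ((hout a).trans ha.2), weight_gateValue]

end AttackTrees

end ChannelSemantics

open ChannelSemantics
theorem mainTheorem2 {B : Type*} {R : Type*} [MetricSemiring R] (α₀ α₁ : B → R)
    (hα : ∀ b, α₀ b + α₁ b = 1) (T : AttackTree B) :
    (∃! F : ChannelFunctor (termGraphs (attackSignature B)) (boolStoch R),
      F.Extends (stochInterpretation α₀ α₁ hα)) ∧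
    ∀ F : ChannelFunctor (termGraphs (attackSignature B)) (boolStoch R),
      F.Extends (stochInterpretation α₀ α₁ hα) →
      (F.map (⟦T⟧ : (termGraphs (attackSignature B)).Channel 0 1)).1 ![true] ![] =
        ∑ a ∈ AttackComponent.successful T,
          (∏ v : AttackComponent.BAS T with a v = true, α₁ (AttackComponent.basLabel T v)) *
          (∏ v : AttackComponent.BAS T with a v = false, α₀ (AttackComponent.basLabel T v)) := by
  refine ⟨⟨semantics _, semantics_extends _, fun F hF => hF.unique (semantics_extends _)⟩,
    fun F hF => ?_⟩
  rw [hF.unique (semantics_extends _)]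
  refine (congrArg Subtype.val (stateSum_attackTree hα T)).trans ?_
  rw [Annihilated.val_sum]
  exact Finset.sum_congr rfl fun a _ => val_prod_attackTerm hα T a
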